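/- Let $q=p^m$ be a power of a prime $p$, let $\mathbb F_q$ be the field with $q$ elements, and let $\psi(x)=\exp(2\pi i\,\mathrm{Tr}(x)/p)$, where $\mathrm{Tr}(x)=\sum_{i=0}^{m-1}x^{p^i}$ is the trace from $\mathbb F_q$ to $\mathbb F_p$. Let $X,Y,Z\subset\mathbb F_q$ satisfy $|X|=|Y|=|Z|$, and suppose that for some constant $C>0$ $$|X\cap cG|\le C\,|G|^{1/2}\qquad\text{for all proper subfields } G \text{ of } \mathbb F_q \text{ and all } c\in\mathbb F_q .$$ Then for all complex weights $(\alpha_x)_{x\in X}$, $(\beta_y)_{y\in Y}$, $(\gamma_z)_{z\in Z}$ with $|\alpha_x|\le1$, $|\beta_y|\le1$, $|\gamma_z|\le 1$ for all $x\in X$, $y\in Y$, $z\in Z$, we have $$\Bigl|\sum_{x\in X}\sum_{y\in Y}\sum_{z\in Z}\alpha_x\beta_y\gamma_z\,\psi(xyz)\Bigr|\ll q^{9/32+o(1)}\Bigl(|X|^{311/128}+q^{-1/128}|X|^{313/128}\Bigr).$$ Here the implied constant depends only on $C$, and $o(1)$ denotes a function of $q$ alone that tends to $0$ as $q\to\infty$.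 -/

import Mathlib

open Filter Topology
open scoped Pointwise

/-- The canonical additive character `ψ(x) = exp(2πi Tr(x) / p)` of a finite field `F` of
characteristic `p`, where `Tr` is the trace from `F` to its prime field. -/
noncomputable def canonicalChar (p : ℕ) [Fact p.Prime] {F : Type*} [Field F]
    [Algebra (ZMod p) F] (x : F) : ℂ :=
  ZMod.stdAddChar (Algebra.trace (ZMod p) F x)

/-- `|X ∩ cG| ≤ C |G|^{1/2}` for all proper subfields `G` of `F` and all `c ∈ F`. -/
def SubfieldAntiConcentrated {F : Type*} [Field F] (C : ℝ) (X : Finset F) : Prop :=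
  ∀ G : Subfield F, G ≠ ⊤ → ∀ c : F,
    (((X : Set F) ∩ c • (G : Set F)).ncard : ℝ) ≤ C * (Nat.card G : ℝ) ^ (1 / 2 : ℝ)

/-- The number of pairs of indices in `I` on which `f` takes the same value. -/
def collisions {ι κ : Type*} [DecidableEq κ] (I : Finset ι) (f : ι → κ) : ℕ :=
  ((I ×ˢ I).filter fun t => f t.1 = f t.2).card

theorem sum_norm_sq_le_collisions {F : Type*} [Field F] [Fintype F] [DecidableEq F]
    {ψ : AddChar F ℂ} (hψ : ψ.IsPrimitive) {ι : Type*} (I : Finset ι) (c : ι → ℂ)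
    (hc : ∀ i ∈ I, ‖c i‖ ≤ 1) (f : ι → F) :
    ∑ w, ‖∑ i ∈ I, c i * ψ (f i * w)‖ ^ 2 ≤ (Fintype.card F : ℝ) * collisions I f := by
  have key : ((∑ w, ‖∑ i ∈ I, c i * ψ (f i * w)‖ ^ 2 : ℝ) : ℂ) =
      ∑ t ∈ I ×ˢ I, c t.1 * (starRingEnd ℂ) (c t.2) *
        (if f t.1 = f t.2 then (Fintype.card F : ℂ) else 0) := by
    push_cast
    have h1 : ∀ w, ((‖∑ i ∈ I, c i * ψ (f i * w)‖ : ℂ)) ^ 2 =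
        ∑ t ∈ I ×ˢ I, c t.1 * (starRingEnd ℂ) (c t.2) * ψ (w * (f t.1 - f t.2)) := by
      intro w
      rw [← Complex.mul_conj', map_sum, Finset.sum_mul_sum, Finset.sum_product]
      refine Finset.sum_congr rfl fun i _ => Finset.sum_congr rfl fun j _ => ?_
      rw [map_mul (starRingEnd ℂ), ← AddChar.map_neg_eq_conj]
      have : w * (f i - f j) = f i * w + -(f j * w) := by ring
      rw [this, AddChar.map_add_eq_mul]
      ring
    simp_rw [h1]
    rw [Finset.sum_comm]
    refine Finset.sum_congr rfl fun t _ => ?_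
    rw [← Finset.mul_sum, AddChar.sum_mulShift _ hψ]
    simp [sub_eq_zero]
  have h0 : 0 ≤ ∑ w, ‖∑ i ∈ I, c i * ψ (f i * w)‖ ^ 2 := by positivity
  rw [← abs_of_nonneg h0, ← Real.norm_eq_abs, ← Complex.norm_real, key]
  refine (norm_sum_le _ _).trans ?_
  have : ∀ t ∈ I ×ˢ I, ‖c t.1 * (starRingEnd ℂ) (c t.2) *
      (if f t.1 = f t.2 then (Fintype.card F : ℂ) else 0)‖ ≤
      if f t.1 = f t.2 then (Fintype.card F : ℝ) else 0 := by
    intro t ht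
    rw [Finset.mem_product] at ht
    rw [norm_mul, norm_mul, RCLike.norm_conj]
    have := mul_le_one₀ (hc _ ht.1) (norm_nonneg _) (hc _ ht.2)
    split_ifs
    · rw [Complex.norm_natCast]
      exact mul_le_of_le_one_left (by positivity) this
    · simp
  refine (Finset.sum_le_sum this).trans ?_
  rw [← Finset.sum_filter, Finset.sum_const, nsmul_eq_mul, mul_comm]
  rfl

theorem collisions_eq_sum_sq {ι κ : Type*} [DecidableEq κ] (I : Finset ι) (f : ι → κ)
    (S : Finset κ) (hS : ∀ i ∈ I, f i ∈ S) :
    collisions I f = ∑ k ∈ S, (I.filter fun i => f i = k).card ^ 2 := by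
  unfold collisions
  rw [Finset.card_eq_sum_card_fiberwise (f := fun t => f t.1) (t := S)]
  · refine Finset.sum_congr rfl fun k _ => ?_
    rw [sq, ← Finset.card_product]
    congr 1
    ext t
    simp only [Finset.mem_filter, Finset.mem_product]
    constructor
    · rintro ⟨⟨⟨h1, h2⟩, h3⟩, h4⟩
      exact ⟨⟨h1, h4⟩, h2, h3 ▸ h4⟩
    · rintro ⟨⟨h1, h2⟩, h3, h4⟩
      exact ⟨⟨⟨h1, h3⟩, h2.trans h4.symm⟩, h2⟩
  · intro t ht
    simp only [Finset.coe_filter, Finset.mem_product, Set.mem_ofPred_eq] at ht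
    exact hS _ ht.1.1

theorem collisions_add_eq_sub {G : Type*} [AddCommGroup G] [DecidableEq G] (A : Finset G) :
    collisions (A ×ˢ A) (fun x : G × G => x.1 + x.2) =
      collisions (A ×ˢ A) (fun x : G × G => x.1 - x.2) := by
  unfold collisions
  refine Finset.card_bij' (fun t _ => ((t.1.1, t.2.2), (t.2.1, t.1.2)))
    (fun t _ => ((t.1.1, t.2.2), (t.2.1, t.1.2))) ?_ ?_ (fun _ _ => rfl) (fun _ _ => rfl)
  · rintro ⟨⟨a, b⟩, c, d⟩ h
    simp only [Finset.mem_filter, Finset.mem_product] at h ⊢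
    refine ⟨by tauto, ?_⟩
    rw [sub_eq_sub_iff_add_eq_add]; exact h.2
  · rintro ⟨⟨a, b⟩, c, d⟩ h
    simp only [Finset.mem_filter, Finset.mem_product] at h ⊢
    refine ⟨by tauto, ?_⟩
    rw [← sub_eq_sub_iff_add_eq_add]; exact h.2

/-- For each `y ≠ 0` the map `z ↦ y z` is injective, so a sum over `Y × Z` is controlled by a
fourth moment over the whole field. -/
theorem trilinear_sum_le_addEnergy {F : Type*} [Field F] [Fintype F] [DecidableEq F]
    {ψ : AddChar F ℂ} (hψ : ψ.IsPrimitive) (U Y Z : Finset F) (hY : (0 : F) ∉ Y)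
    {N : ℝ} (hYN : (Y.card : ℝ) ≤ N) (hZN : (Z.card : ℝ) ≤ N)
    (α β γ : F → ℂ) (hα : ∀ x ∈ U, ‖α x‖ ≤ 1) (hβ : ∀ y ∈ Y, ‖β y‖ ≤ 1)
    (hγ : ∀ z ∈ Z, ‖γ z‖ ≤ 1) :
    ‖∑ x ∈ U, ∑ y ∈ Y, ∑ z ∈ Z, α x * β y * γ z * ψ (x * y * z)‖ ^ 4 ≤
      N ^ 7 * Fintype.card F * collisions (U ×ˢ U) (fun x : F × F => x.1 - x.2) := by
  set f : F → ℝ := fun w => ‖∑ x ∈ U, α x * ψ (x * w)‖ with hf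
  have hN : 0 ≤ N := le_trans (by positivity) hYN
  have h1 : ‖∑ x ∈ U, ∑ y ∈ Y, ∑ z ∈ Z, α x * β y * γ z * ψ (x * y * z)‖ ≤
      ∑ t ∈ Y ×ˢ Z, f (t.1 * t.2) := by
    have : ∑ x ∈ U, ∑ y ∈ Y, ∑ z ∈ Z, α x * β y * γ z * ψ (x * y * z) =
        ∑ t ∈ Y ×ˢ Z, β t.1 * γ t.2 * ∑ x ∈ U, α x * ψ (x * (t.1 * t.2)) := by
      simp_rw [← Finset.sum_product', Finset.mul_sum]
      rw [Finset.sum_product, Finset.sum_comm]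
      refine Finset.sum_congr rfl fun t _ => Finset.sum_congr rfl fun x _ => ?_
      rw [mul_assoc x]; ring
    rw [this]
    refine (norm_sum_le _ _).trans (Finset.sum_le_sum fun t ht => ?_)
    rw [Finset.mem_product] at ht
    rw [norm_mul, norm_mul]
    exact mul_le_of_le_one_left (norm_nonneg _)
      (mul_le_one₀ (hβ _ ht.1) (norm_nonneg _) (hγ _ ht.2))
  have h2 : (∑ t ∈ Y ×ˢ Z, f (t.1 * t.2)) ^ 4 ≤
      ((Y ×ˢ Z).card : ℝ) ^ 3 * ∑ t ∈ Y ×ˢ Z, f (t.1 * t.2) ^ 4 :=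
    pow_sum_le_card_mul_sum_pow (fun t _ => norm_nonneg _) 3
  have h3 : ∑ t ∈ Y ×ˢ Z, f (t.1 * t.2) ^ 4 ≤ Y.card * ∑ w, f w ^ 4 := by
    rw [Finset.sum_product, ← nsmul_eq_mul]
    refine Finset.sum_le_card_nsmul _ _ _ fun y hy => ?_
    have hy0 : y ≠ 0 := fun h => hY (h ▸ hy)
    have : ∑ z ∈ Z, f (y * z) ^ 4 = ∑ w ∈ Z.image (y * ·), f w ^ 4 := by
      rw [Finset.sum_image]
      intro a _ b _ h
      exact mul_left_cancel₀ hy0 h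
    show ∑ z ∈ Z, f (y * z) ^ 4 ≤ _
    rw [this]
    exact Finset.sum_le_univ_sum_of_nonneg fun w => by positivity
  have h4 : ∑ w, f w ^ 4 ≤
      Fintype.card F * collisions (U ×ˢ U) (fun x : F × F => x.1 - x.2) := by
    rw [← collisions_add_eq_sub]
    have := sum_norm_sq_le_collisions hψ (U ×ˢ U) (fun t => α t.1 * α t.2) (fun t ht => by
      rw [Finset.mem_product] at ht
      rw [norm_mul]
      exact mul_le_one₀ (hα _ ht.1) (norm_nonneg _) (hα _ ht.2)) (fun t => t.1 + t.2)
    refine le_trans (le_of_eq (Finset.sum_congr rfl fun w _ => ?_)) this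
    have e : ∑ i ∈ U ×ˢ U, α i.1 * α i.2 * ψ ((i.1 + i.2) * w) =
        (∑ x ∈ U, α x * ψ (x * w)) ^ 2 := by
      rw [sq, Finset.sum_mul_sum, Finset.sum_product]
      refine Finset.sum_congr rfl fun i _ => Finset.sum_congr rfl fun j _ => ?_
      rw [add_mul, AddChar.map_add_eq_mul]; ring
    rw [e, norm_pow]; simp only [hf]; ring
  calc _ ≤ (∑ t ∈ Y ×ˢ Z, f (t.1 * t.2)) ^ 4 := by gcongr
    _ ≤ _ := h2
    _ ≤ ((Y ×ˢ Z).card : ℝ) ^ 3 * (Y.card * (Fintype.card F *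
        collisions (U ×ˢ U) (fun x : F × F => x.1 - x.2))) := by
      gcongr; exact h3.trans (by gcongr)
    _ ≤ (N * N) ^ 3 * (N * (Fintype.card F *
        collisions (U ×ˢ U) (fun x : F × F => x.1 - x.2))) := by
      rw [Finset.card_product]; push_cast; gcongr
    _ = _ := by ring

theorem trilinear_sum_le_mulCollisions {F : Type*} [Field F] [Fintype F] [DecidableEq F]
    {ψ : AddChar F ℂ} (hψ : ψ.IsPrimitive) (B Y Z : Finset F)
    (α β γ : F → ℂ) (hα : ∀ x ∈ B, ‖α x‖ ≤ 1) (hβ : ∀ y ∈ Y, ‖β y‖ ≤ 1)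
    (hγ : ∀ z ∈ Z, ‖γ z‖ ≤ 1) :
    ‖∑ x ∈ B, ∑ y ∈ Y, ∑ z ∈ Z, α x * β y * γ z * ψ (x * y * z)‖ ^ 2 ≤
      Z.card * (Fintype.card F * collisions (B ×ˢ Y) (fun x : F × F => x.1 * x.2)) := by
  set g : F → ℝ := fun w => ‖∑ t ∈ B ×ˢ Y, α t.1 * β t.2 * ψ (t.1 * t.2 * w)‖ with hg
  have h1 : ‖∑ x ∈ B, ∑ y ∈ Y, ∑ z ∈ Z, α x * β y * γ z * ψ (x * y * z)‖ ≤ ∑ z ∈ Z, g z := by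
    have : ∑ x ∈ B, ∑ y ∈ Y, ∑ z ∈ Z, α x * β y * γ z * ψ (x * y * z) =
        ∑ z ∈ Z, γ z * ∑ t ∈ B ×ˢ Y, α t.1 * β t.2 * ψ (t.1 * t.2 * z) := by
      simp_rw [Finset.mul_sum]
      rw [← Finset.sum_product', Finset.sum_comm]
      refine Finset.sum_congr rfl fun t _ => Finset.sum_congr rfl fun x _ => ?_
      ring
    rw [this]
    refine (norm_sum_le _ _).trans (Finset.sum_le_sum fun t ht => ?_)
    rw [norm_mul]
    exact mul_le_of_le_one_left (norm_nonneg _) (hγ _ ht)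
  calc _ ≤ (∑ z ∈ Z, g z) ^ 2 := by gcongr
    _ ≤ Z.card * ∑ z ∈ Z, g z ^ 2 := sq_sum_le_card_mul_sum_sq
    _ ≤ Z.card * ∑ z, g z ^ 2 := by
      refine mul_le_mul_of_nonneg_left ?_ (by positivity)
      exact Finset.sum_le_univ_sum_of_nonneg fun w => by positivity
    _ ≤ _ := by
      gcongr
      refine sum_norm_sq_le_collisions hψ (B ×ˢ Y) (fun t => α t.1 * β t.2) (fun t ht => ?_)
        (fun t => t.1 * t.2)
      rw [Finset.mem_product] at ht
      rw [norm_mul]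
      exact mul_le_one₀ (hα _ ht.1) (norm_nonneg _) (hβ _ ht.2)

theorem collisions_mul_eq_div {F : Type*} [Field F] [DecidableEq F] (B Y : Finset F)
    (hB : (0 : F) ∉ B) (hY : (0 : F) ∉ Y) :
    collisions (B ×ˢ Y) (fun x : F × F => x.1 * x.2) =
      (((B ×ˢ B) ×ˢ (Y ×ˢ Y)).filter fun t => t.1.1 / t.1.2 = t.2.1 / t.2.2).card := by
  unfold collisions
  refine Finset.card_bij' (fun t _ => ((t.1.1, t.2.1), (t.2.2, t.1.2)))
    (fun t _ => ((t.1.1, t.2.2), (t.1.2, t.2.1))) ?_ ?_ (fun _ _ => rfl) (fun _ _ => rfl)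
  · rintro ⟨⟨a, b⟩, c, d⟩ h
    simp only [Finset.mem_filter, Finset.mem_product] at h ⊢
    refine ⟨by tauto, ?_⟩
    rw [div_eq_div_iff (fun h0 => hB (h0 ▸ h.1.2.1)) (fun h0 => hY (h0 ▸ h.1.1.2)), h.2,
      mul_comm]
  · rintro ⟨⟨a, b⟩, c, d⟩ h
    simp only [Finset.mem_filter, Finset.mem_product] at h ⊢
    refine ⟨by tauto, ?_⟩
    have := h.2
    rw [div_eq_div_iff (fun h0 => hB (h0 ▸ h.1.1.2)) (fun h0 => hY (h0 ▸ h.1.2.2))] at this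
    rw [this, mul_comm]

theorem collisions_mul_eq_sum {F : Type*} [Field F] [Fintype F] [DecidableEq F] (B Y : Finset F)
    (hB : (0 : F) ∉ B) (hY : (0 : F) ∉ Y) :
    collisions (B ×ˢ Y) (fun x : F × F => x.1 * x.2) =
      ∑ k, ((B ×ˢ B).filter fun t => t.1 / t.2 = k).card *
        ((Y ×ˢ Y).filter fun t => t.1 / t.2 = k).card := by
  rw [collisions_mul_eq_div B Y hB hY,
    Finset.card_eq_sum_card_fiberwise (f := fun t => t.1.1 / t.1.2) (t := Finset.univ)
      (fun _ _ => Finset.mem_coe.2 (Finset.mem_univ _))]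
  refine Finset.sum_congr rfl fun k _ => ?_
  rw [← Finset.card_product]
  congr 1
  ext t
  simp only [Finset.mem_filter, Finset.mem_product]
  constructor
  · rintro ⟨⟨⟨h1, h2⟩, h3⟩, h4⟩
    exact ⟨⟨h1, h4⟩, h2, h3 ▸ h4⟩
  · rintro ⟨⟨h1, h2⟩, h3, h4⟩
    exact ⟨⟨⟨h1, h3⟩, h2.trans h4.symm⟩, h2⟩

theorem collisions_mul_sq_le {F : Type*} [Field F] [Fintype F] [DecidableEq F] (B Y : Finset F)
    (hB : (0 : F) ∉ B) (hY : (0 : F) ∉ Y) :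
    collisions (B ×ˢ Y) (fun x : F × F => x.1 * x.2) ^ 2 ≤
      collisions (B ×ˢ B) (fun x : F × F => x.1 * x.2) *
        collisions (Y ×ˢ Y) (fun x : F × F => x.1 * x.2) := by
  rw [collisions_mul_eq_sum B Y hB hY, collisions_mul_eq_sum B B hB hB,
    collisions_mul_eq_sum Y Y hY hY]
  simp_rw [← sq]
  exact Finset.sum_mul_sq_le_sq_mul_sq _ _ _

theorem collisions_mul_self_le {F : Type*} [Field F] [DecidableEq F] (Y : Finset F)
    (hY : (0 : F) ∉ Y) :
    collisions (Y ×ˢ Y) (fun x : F × F => x.1 * x.2) ≤ Y.card ^ 3 := by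
  have : Y.card ^ 3 = ((Y ×ˢ Y) ×ˢ Y).card := by simp only [Finset.card_product]; ring
  rw [this]
  refine Finset.card_le_card_of_injOn (fun t => (t.1, t.2.1)) ?_ ?_
  · rintro ⟨⟨a, b⟩, c, d⟩ h
    simp only [Finset.coe_filter, Finset.coe_product, Finset.mem_product, Set.mem_ofPred_eq,
      Set.mem_prod, Finset.mem_coe] at h ⊢
    tauto
  · rintro ⟨⟨a, b⟩, c, d⟩ h ⟨⟨a', b'⟩, c', d'⟩ h' e
    simp only [Finset.coe_filter, Finset.mem_product, Set.mem_ofPred_eq, Prod.mk.injEq] at h h' e ⊢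
    obtain ⟨⟨rfl, rfl⟩, rfl⟩ := e
    refine ⟨⟨rfl, rfl⟩, rfl, ?_⟩
    have hc : c ≠ 0 := fun h0 => hY (h0 ▸ h.1.2.1)
    exact mul_left_cancel₀ hc (h.2.symm.trans h'.2)

theorem card_filter_mem_eq_sum {α β : Type*} [DecidableEq β] (s : Finset α) (t : Finset β)
    (f : α → β) :
    (s.filter fun a => f a ∈ t).card = ∑ b ∈ t, (s.filter fun a => f a = b).card := by
  rw [Finset.card_eq_sum_card_fiberwise (f := f) (t := t)
    (fun a ha => Finset.mem_coe.2 (Finset.mem_filter.1 (Finset.mem_coe.1 ha)).2)]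
  refine Finset.sum_congr rfl fun b hb => ?_
  rw [Finset.filter_filter]
  congr 1
  ext a
  simp only [Finset.mem_filter]
  constructor
  · rintro ⟨h1, -, h2⟩; exact ⟨h1, h2⟩
  · rintro ⟨h1, h2⟩; exact ⟨h1, h2 ▸ hb, h2⟩

theorem card_mul_le_card_of_fiber_le {α β : Type*} [DecidableEq β] (s : Finset α) (t : Finset β)
    (f : α → β) (m : ℝ) (h : ∀ b ∈ t, m ≤ (s.filter fun a => f a = b).card) :
    t.card * m ≤ s.card := by
  calc (t.card : ℝ) * m = t.card • m := by rw [nsmul_eq_mul]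
    _ ≤ ∑ b ∈ t, ((s.filter fun a => f a = b).card : ℝ) := Finset.card_nsmul_le_sum _ _ _ h
    _ = ((s.filter fun a => f a ∈ t).card : ℝ) := by rw [card_filter_mem_eq_sum]; push_cast; rfl
    _ ≤ _ := by exact_mod_cast Finset.card_filter_le _ _

/-- Dyadic pigeonholing: a set of differences, all of about the same popularity, that
carries a logarithmic proportion of the additive energy. -/
theorem exists_popular_differences {G : Type*} [AddCommGroup G] [DecidableEq G] (A : Finset G)
    (hA : A.Nonempty) :
    ∃ D : Finset G,
      0 < ((A ×ˢ A).filter fun t => t.1 - t.2 ∈ D).card ∧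
      D.card * collisions (A ×ˢ A) (fun t : G × G => t.1 - t.2) ≤
        2 * (Nat.log 2 A.card + 1) * ((A ×ˢ A).filter fun t => t.1 - t.2 ∈ D).card ^ 2 := by
  set r : G → ℕ := fun d => ((A ×ˢ A).filter fun t => t.1 - t.2 = d).card with hr
  have hrle : ∀ d, r d ≤ A.card := by
    intro d
    refine Finset.card_le_card_of_injOn (fun t => t.1) ?_ ?_
    · intro t ht
      simp only [Finset.coe_filter, Finset.mem_product, Set.mem_ofPred_eq] at ht
      exact ht.1.1
    · rintro ⟨a, b⟩ h ⟨a', b'⟩ h' e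
      simp only [Finset.coe_filter, Finset.mem_product, Set.mem_ofPred_eq] at h h' e
      subst e
      rw [← h'.2] at h
      simpa using h.2
  set E := collisions (A ×ˢ A) (fun t : G × G => t.1 - t.2) with hE
  have hEsum : E = ∑ d ∈ A - A, r d ^ 2 :=
    collisions_eq_sum_sq _ _ _ fun t ht => by
      rw [Finset.mem_product] at ht; exact Finset.sub_mem_sub ht.1 ht.2
  have hrpos : ∀ d ∈ A - A, 0 < r d := by
    intro d hd
    obtain ⟨a, ha, b, hb, rfl⟩ := Finset.mem_sub.1 hd
    exact Finset.card_pos.2 ⟨(a, b), by simp [ha, hb]⟩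
  set ℓ := Nat.log 2 A.card + 1 with hℓ
  set Dj : ℕ → Finset G := fun j => (A - A).filter fun d => Nat.log 2 (r d) = j with hDj
  have hpart : ∑ j ∈ Finset.range ℓ, ∑ d ∈ Dj j, r d ^ 2 = E := by
    rw [hEsum]
    exact Finset.sum_fiberwise_of_maps_to (fun d _ => by
      rw [Finset.mem_range, hℓ]
      exact Nat.lt_succ_of_le (Nat.log_mono_right (hrle d))) _
  have hEpos : 0 < E := by
    obtain ⟨a, ha⟩ := hA
    exact Finset.card_pos.2 ⟨((a, a), (a, a)), by simp [ha]⟩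
  obtain ⟨j, hj, hjE⟩ : ∃ j ∈ Finset.range ℓ, E ≤ ℓ * ∑ d ∈ Dj j, r d ^ 2 := by
    by_contra! hcon
    have h1 : ∑ j ∈ Finset.range ℓ, ℓ * ∑ d ∈ Dj j, r d ^ 2 < ∑ j ∈ Finset.range ℓ, E :=
      Finset.sum_lt_sum_of_nonempty ⟨0, by simp [hℓ]⟩ hcon
    rw [← Finset.mul_sum, hpart, Finset.sum_const, Finset.card_range, smul_eq_mul] at h1
    exact lt_irrefl _ h1
  have he : ((A ×ˢ A).filter fun t => t.1 - t.2 ∈ Dj j).card = ∑ d ∈ Dj j, r d :=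
    card_filter_mem_eq_sum _ _ _
  have hlow : ∀ d ∈ Dj j, 2 ^ j ≤ r d := by
    intro d hd
    rw [hDj, Finset.mem_filter] at hd
    rw [← hd.2]
    exact Nat.pow_log_le_self 2 (hrpos d hd.1).ne'
  have hup : ∀ d ∈ Dj j, r d ≤ 2 * 2 ^ j := by
    intro d hd
    rw [hDj, Finset.mem_filter] at hd
    rw [← hd.2, ← pow_succ']
    exact (Nat.lt_pow_succ_log_self (by norm_num) _).le
  refine ⟨Dj j, ?_, ?_⟩
  · rw [he]
    by_contra hcon
    have h0 : ∀ d ∈ Dj j, r d = 0 := Finset.sum_eq_zero_iff.1 (by omega)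
    rw [Finset.sum_eq_zero (fun d hd => by rw [h0 d hd]; rfl)] at hjE
    omega
  · rw [he]
    have h1 : (Dj j).card * 2 ^ j ≤ ∑ d ∈ Dj j, r d := by
      simpa using Finset.card_nsmul_le_sum _ _ _ hlow
    have h2 : ∑ d ∈ Dj j, r d ^ 2 ≤ 2 * 2 ^ j * ∑ d ∈ Dj j, r d := by
      rw [Finset.mul_sum]
      exact Finset.sum_le_sum fun d hd => by rw [sq]; exact Nat.mul_le_mul_right _ (hup d hd)
    calc (Dj j).card * E ≤ (Dj j).card * (ℓ * (2 * 2 ^ j * ∑ d ∈ Dj j, r d)) := by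
          gcongr; exact hjE.trans (by gcongr)
      _ = 2 * ℓ * ((Dj j).card * 2 ^ j) * ∑ d ∈ Dj j, r d := by ring
      _ ≤ 2 * ℓ * (∑ d ∈ Dj j, r d) * ∑ d ∈ Dj j, r d := by gcongr
      _ = _ := by rw [hℓ]; ring

/-- The number of common neighbours of `a` and `b` in `A`. -/
def codegree {V : Type*} (A : Finset V) (r : V → V → Prop) [DecidableRel r] (a b : V) : ℕ :=
  (A.filter fun x => r a x ∧ r b x).card

theorem sum_card_low_codegree_le {V : Type*} (A A₁ : Finset V) (hA₁ : A₁ ⊆ A)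
    (r : V → V → Prop) [DecidableRel r] (N t : ℝ) (hN : (A.card : ℝ) ≤ N) (ht : 0 ≤ t) :
    ∑ v ∈ A, ((((A₁.filter fun a => r a v) ×ˢ (A₁.filter fun a => r a v)).filter
      fun p => (codegree A r p.1 p.2 : ℝ) < t).card : ℝ) ≤ N ^ 2 * t := by
  classical
  have hN0 : 0 ≤ N := le_trans (by positivity) hN
  have e1 : ∀ v, ((A₁.filter fun a => r a v) ×ˢ (A₁.filter fun a => r a v)).filter
      (fun p => (codegree A r p.1 p.2 : ℝ) < t) =
      ((A₁ ×ˢ A₁).filter fun p => (codegree A r p.1 p.2 : ℝ) < t).filter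
        fun p => r p.1 v ∧ r p.2 v := by
    intro v; ext p
    simp only [Finset.mem_filter, Finset.mem_product]; tauto
  simp_rw [e1, Finset.card_filter _ (((A₁ ×ˢ A₁).filter _))]
  push_cast
  rw [Finset.sum_comm]
  have h2 : ∀ p ∈ (A₁ ×ˢ A₁).filter (fun p => (codegree A r p.1 p.2 : ℝ) < t),
      (∑ v ∈ A, if r p.1 v ∧ r p.2 v then (1 : ℝ) else 0) ≤ t := by
    intro p hp
    rw [Finset.mem_filter] at hp
    rw [← Finset.sum_filter, Finset.sum_const, nsmul_eq_mul, mul_one]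
    exact hp.2.le
  refine (Finset.sum_le_card_nsmul _ _ _ h2).trans ?_
  rw [nsmul_eq_mul]
  gcongr
  refine (Nat.cast_le.2 (Finset.card_filter_le _ _)).trans ?_
  rw [Finset.card_product]
  push_cast
  have : (A₁.card : ℝ) ≤ N := le_trans (by exact_mod_cast Finset.card_le_card hA₁) hN
  rw [sq]; gcongr

theorem card_filter_many_mul_le {V : Type*} [DecidableEq V] (S : Finset V) (P : V → V → Prop)
    [DecidableRel P] (m : ℝ) :
    ((S.filter fun a => m < (S.filter fun b => P a b).card).card : ℝ) * m ≤
      ((S ×ˢ S).filter fun p => P p.1 p.2).card := by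
  refine card_mul_le_card_of_fiber_le _ _ (fun p => p.1) m fun b hb => ?_
  rw [Finset.mem_filter] at hb
  refine hb.2.le.trans ?_
  norm_cast
  refine Finset.card_le_card_of_injOn (fun y => (b, y)) ?_ ?_
  · intro y hy
    simp only [Finset.coe_filter, Finset.mem_filter, Finset.mem_product, Set.mem_ofPred_eq] at hy ⊢
    exact ⟨⟨⟨hb.1, hy.1⟩, hy.2⟩, trivial⟩
  · intro y _ y' _ h
    simpa using h

theorem sum_card_filter_comm {V W : Type*} (A : Finset V) (B : Finset W) (r : V → W → Prop)
    [∀ a b, Decidable (r a b)] :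
    ∑ v ∈ B, ((A.filter fun a => r a v).card : ℝ) =
      ∑ a ∈ A, ((B.filter fun v => r a v).card : ℝ) := by
  simp_rw [Finset.card_filter]
  push_cast
  exact Finset.sum_comm

theorem card_filter_product_eq_sum {V W : Type*} (A : Finset V) (B : Finset W) (r : V → W → Prop)
    [∀ a b, Decidable (r a b)] :
    (((A ×ˢ B).filter fun t => r t.1 t.2).card : ℝ) =
      ∑ a ∈ A, ((B.filter fun v => r a v).card : ℝ) := by
  simp_rw [Finset.card_filter]
  push_cast
  rw [Finset.sum_product]

/-- If `Σ_{x ∈ I} f x` is large with `f ≤ M`, many `x` have `f x` at least half the average. -/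
theorem sum_le_card_filter_mul_add {ι : Type*} (I : Finset ι) (f : ι → ℝ) (M c : ℝ)
    (hc : 0 ≤ c) (hM : ∀ i ∈ I, f i ≤ M) :
    ∑ i ∈ I, f i ≤ (I.filter fun i => c ≤ f i).card * M + I.card * c := by
  rw [← Finset.sum_filter_add_sum_filter_not I (fun i => c ≤ f i)]
  gcongr
  · rw [← nsmul_eq_mul]
    exact Finset.sum_le_card_nsmul _ _ _ fun i hi => hM i (Finset.mem_filter.1 hi).1
  · refine (Finset.sum_le_card_nsmul _ _ c fun i hi => ?_).trans ?_
    · exact (not_le.1 (Finset.mem_filter.1 hi).2).le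
    · rw [nsmul_eq_mul]
      gcongr
      exact Finset.filter_subset _ _

set_option maxHeartbeats 400000 in
/-- Graph-theoretic form of the Balog–Szemerédi–Gowers theorem, with paths of length four inside
`B` and paths of length three between `B` and an auxiliary set `W`. -/
theorem exists_subset_many_paths {V : Type*} [DecidableEq V] (A : Finset V) (r : V → V → Prop)
    [DecidableRel r] (N δ : ℝ) (hN : (A.card : ℝ) ≤ N) (hN0 : 0 < N)
    (hδ : 0 < δ) (he : δ * N ^ 2 ≤ ((A ×ˢ A).filter fun t => r t.1 t.2).card) :
    ∃ B ⊆ A, ∃ W ⊆ A, δ * N / 6 ≤ B.card ∧ δ * N / 4 ≤ W.card ∧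
      (∀ b ∈ B, ∀ b' ∈ B, B.card * δ ^ 4 * N ^ 2 / 2 ^ 21 ≤
        ((A ×ˢ (A ×ˢ A)).filter fun p =>
          r b p.2.1 ∧ r p.1 p.2.1 ∧ r b' p.2.2 ∧ r p.1 p.2.2).card) ∧
      (∀ b ∈ B, ∀ w ∈ W, B.card * δ ^ 4 * N / 2 ^ 14 ≤
        ((A ×ˢ A).filter fun p => r b p.2 ∧ r p.1 p.2 ∧ r p.1 w).card) := by
  set deg : V → ℝ := fun a => ((A.filter fun x => r a x).card : ℝ) with hdeg
  set A₁ := A.filter fun a => δ * N / 2 ≤ deg a with hA₁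
  have hA₁A : A₁ ⊆ A := Finset.filter_subset _ _
  set S : V → Finset V := fun v => A₁.filter fun a => r a v with hS
  set cod := codegree A r with hcod
  set t₁ := δ ^ 2 * N / 1024 with ht₁
  set t₂ := δ ^ 3 * N / 1024 with ht₂
  have hAne : A.Nonempty := by
    by_contra h
    rw [Finset.not_nonempty_iff_eq_empty] at h
    rw [h] at he
    simp at he
    have : 0 < δ * N ^ 2 := by positivity
    linarith
  have hsum : δ * N ^ 2 / 2 ≤ ∑ v ∈ A, ((S v).card : ℝ) := by
    rw [sum_card_filter_comm A₁ A r]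
    rw [card_filter_product_eq_sum A A r,
      ← Finset.sum_filter_add_sum_filter_not A (fun a => δ * N / 2 ≤ deg a)] at he
    have : ∑ a ∈ A.filter (fun a => ¬ δ * N / 2 ≤ deg a), deg a ≤ N * (δ * N / 2) := by
      refine (Finset.sum_le_card_nsmul _ _ (δ * N / 2) fun i hi => ?_).trans ?_
      · exact (not_le.1 (Finset.mem_filter.1 hi).2).le
      · rw [nsmul_eq_mul]
        gcongr
        exact le_trans (by exact_mod_cast Finset.card_filter_le _ _) hN
    have e : N * (δ * N / 2) = δ * N ^ 2 / 2 := by ring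
    rw [e] at this
    simp only [hdeg] at this
    linarith
  set bad : ℝ → V → ℝ := fun t v => (((S v ×ˢ S v).filter
      fun p => (cod p.1 p.2 : ℝ) < t).card : ℝ) with hbad
  obtain ⟨v, hv, hvs⟩ : ∃ v ∈ A, δ ^ 2 * N ^ 2 / 8 + 64 * bad t₁ v + 64 / δ * bad t₂ v ≤
      ((S v).card : ℝ) ^ 2 := by
    by_contra hcon
    have h1 : ∑ v ∈ A, ((S v).card : ℝ) ^ 2 <
        ∑ v ∈ A, (δ ^ 2 * N ^ 2 / 8 + 64 * bad t₁ v + 64 / δ * bad t₂ v) :=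
      Finset.sum_lt_sum_of_nonempty hAne fun v hv => not_le.1 fun h => hcon ⟨v, hv, h⟩
    rw [Finset.sum_add_distrib, Finset.sum_add_distrib, ← Finset.mul_sum, ← Finset.mul_sum,
      Finset.sum_const, nsmul_eq_mul] at h1
    have b1 : ∑ v ∈ A, bad t₁ v ≤ N ^ 2 * t₁ :=
      sum_card_low_codegree_le A A₁ hA₁A r N t₁ hN (by positivity)
    have b2 : ∑ v ∈ A, bad t₂ v ≤ N ^ 2 * t₂ :=
      sum_card_low_codegree_le A A₁ hA₁A r N t₂ hN (by positivity)
    have h2 : (∑ v ∈ A, ((S v).card : ℝ)) ^ 2 ≤ N * ∑ v ∈ A, ((S v).card : ℝ) ^ 2 :=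
      sq_sum_le_card_mul_sum_sq.trans
        (mul_le_mul_of_nonneg_right hN (Finset.sum_nonneg fun _ _ => sq_nonneg _))
    have h3 : (δ * N ^ 2 / 2) ^ 2 ≤ (∑ v ∈ A, ((S v).card : ℝ)) ^ 2 :=
      pow_le_pow_left₀ (by positivity) hsum 2
    have h4 : ∑ v ∈ A, ((S v).card : ℝ) ^ 2 < δ ^ 2 * N ^ 3 / 4 := by
      calc _ < _ := h1
        _ ≤ N * (δ ^ 2 * N ^ 2 / 8) + 64 * (N ^ 2 * t₁) + 64 / δ * (N ^ 2 * t₂) :=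
          add_le_add (add_le_add (mul_le_mul_of_nonneg_right hN (by positivity))
            (mul_le_mul_of_nonneg_left b1 (by positivity)))
            (mul_le_mul_of_nonneg_left b2 (by positivity))
        _ = δ ^ 2 * N ^ 3 / 4 := by rw [ht₁, ht₂]; field_simp; ring
    have h5 : N * ∑ v ∈ A, ((S v).card : ℝ) ^ 2 < N * (δ ^ 2 * N ^ 3 / 4) := by gcongr
    have e : (δ * N ^ 2 / 2) ^ 2 = N * (δ ^ 2 * N ^ 3 / 4) := by ring
    linarith
  set s : ℝ := ((S v).card : ℝ) with hs
  have hbad0 : ∀ t, 0 ≤ bad t v := fun t => by positivity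
  have hsq : δ ^ 2 * N ^ 2 / 8 ≤ s ^ 2 := by
    have := hbad0 t₁
    have := mul_nonneg (show 0 ≤ 64 / δ by positivity) (hbad0 t₂)
    linarith
  have hs3 : δ * N / 3 ≤ s := by
    refine abs_le_of_sq_le_sq' ?_ (by positivity) |>.2
    refine le_trans ?_ hsq
    have : 0 ≤ δ ^ 2 * N ^ 2 := by positivity
    ring_nf
    linarith
  have hs0 : 0 < s := lt_of_lt_of_le (by positivity) hs3
  have hbad1 : bad t₁ v ≤ s ^ 2 / 64 := by
    have := mul_nonneg (show 0 ≤ 64 / δ by positivity) (hbad0 t₂)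
    have : 0 ≤ δ ^ 2 * N ^ 2 / 8 := by positivity
    linarith
  have hbad2 : bad t₂ v ≤ δ * s ^ 2 / 64 := by
    have := hbad0 t₁
    have h0 : 0 ≤ δ ^ 2 * N ^ 2 / 8 := by positivity
    have h1 : 64 / δ * bad t₂ v ≤ s ^ 2 := by linarith
    calc bad t₂ v = δ / 64 * (64 / δ * bad t₂ v) := by field_simp
      _ ≤ δ / 64 * s ^ 2 := by gcongr
      _ = _ := by ring
  set bd : ℝ → V → ℝ := fun t b => (((S v).filter fun y => (cod b y : ℝ) < t).card : ℝ) with hbd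
  set T₁ := (S v).filter fun b => s / 4 < bd t₁ b with hT₁
  set T₂ := (S v).filter fun b => δ * s / 16 < bd t₂ b with hT₂
  have hT₁c : (T₁.card : ℝ) ≤ s / 16 := by
    have := (card_filter_many_mul_le (S v) (fun b y => (cod b y : ℝ) < t₁) (s / 4)).trans hbad1
    have : (T₁.card : ℝ) * (s / 4) ≤ s / 16 * (s / 4) := this.trans (by ring_nf; rfl)
    exact le_of_mul_le_mul_right this (by positivity)
  have hT₂c : (T₂.card : ℝ) ≤ s / 4 := by
    have := (card_filter_many_mul_le (S v) (fun b y => (cod b y : ℝ) < t₂)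
      (δ * s / 16)).trans hbad2
    have : (T₂.card : ℝ) * (δ * s / 16) ≤ s / 4 * (δ * s / 16) := this.trans (by ring_nf; rfl)
    exact le_of_mul_le_mul_right this (by positivity)
  set B := S v \ (T₁ ∪ T₂) with hB
  have hBS : B ⊆ S v := Finset.sdiff_subset
  have hSA : S v ⊆ A := (Finset.filter_subset _ _).trans hA₁A
  have hBs : (B.card : ℝ) ≤ s := Nat.cast_le.2 (Finset.card_le_card hBS)
  have hBc : s / 2 ≤ B.card := by
    have h1 : (S v).card ≤ B.card + (T₁ ∪ T₂).card :=
      Nat.sub_le_iff_le_add.1 (Finset.le_card_sdiff (T₁ ∪ T₂) (S v))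
    have h2 := Finset.card_union_le T₁ T₂
    have h3 : s ≤ B.card + (T₁.card + T₂.card) := by
      rw [hs]; exact_mod_cast h1.trans (Nat.add_le_add_left h2 _)
    linarith
  have hBbd : ∀ b ∈ B, bd t₁ b ≤ s / 4 ∧ bd t₂ b ≤ δ * s / 16 := by
    intro b hb
    simp only [hB, Finset.mem_sdiff, Finset.mem_union, not_or] at hb
    constructor
    · by_contra h
      exact hb.2.1 (Finset.mem_filter.2 ⟨hb.1, not_le.1 h⟩)
    · by_contra h
      exact hb.2.2 (Finset.mem_filter.2 ⟨hb.1, not_le.1 h⟩)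
  set W := A.filter fun z => δ * s / 8 ≤ (((S v).filter fun y => r y z).card : ℝ) with hW
  refine ⟨B, hBS.trans hSA, W, Finset.filter_subset _ _, by linarith, ?_, ?_, ?_⟩
  · have h1 : s * (δ * N / 2) ≤ ∑ y ∈ S v, deg y := by
      rw [hs, ← nsmul_eq_mul]
      refine Finset.card_nsmul_le_sum _ _ _ fun y hy => ?_
      exact (Finset.mem_filter.1 (Finset.mem_filter.1 hy).1).2
    simp only [hdeg] at h1
    rw [← sum_card_filter_comm (S v) A r] at h1
    have h2 := sum_le_card_filter_mul_add A (fun z => (((S v).filter fun y => r y z).card : ℝ)) s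
      (δ * s / 8) (by positivity) (fun z _ => by
        rw [hs]; exact_mod_cast Finset.card_filter_le _ _)
    have h3 : (A.card : ℝ) * (δ * s / 8) ≤ N * (δ * s / 8) := by gcongr
    have h4 : δ * N * 3 / 8 * s ≤ W.card * s := by
      calc δ * N * 3 / 8 * s = s * (δ * N / 2) - N * (δ * s / 8) := by ring
        _ ≤ _ := by linarith
    have h5 := le_of_mul_le_mul_right h4 hs0
    have : 0 ≤ δ * N := by positivity
    linarith
  · intro b hb b' hb'
    set Y := (S v).filter fun y => t₁ ≤ cod b y ∧ t₁ ≤ cod b' y with hY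
    have hYc : s / 2 ≤ Y.card := by
      have h1 : S v ⊆ Y ∪ ((S v).filter (fun y => (cod b y : ℝ) < t₁) ∪
          (S v).filter (fun y => (cod b' y : ℝ) < t₁)) := by
        intro y hy
        simp only [hY, Finset.mem_union, Finset.mem_filter]
        by_cases c1 : (cod b y : ℝ) < t₁
        · right; left; exact ⟨hy, c1⟩
        by_cases c2 : (cod b' y : ℝ) < t₁
        · right; right; exact ⟨hy, c2⟩
        left; exact ⟨hy, not_lt.1 c1, not_lt.1 c2⟩
      have h2 : s ≤ Y.card + (bd t₁ b + bd t₁ b') := by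
        rw [hs]
        refine (Nat.cast_le.2 (Finset.card_le_card h1)).trans ?_
        refine (Nat.cast_le.2 (Finset.card_union_le _ _)).trans ?_
        rw [Nat.cast_add]
        gcongr
        refine (Nat.cast_le.2 (Finset.card_union_le _ _)).trans ?_
        rw [Nat.cast_add]
      linarith [(hBbd b hb).1, (hBbd b' hb').1]
    have h1 := card_mul_le_card_of_fiber_le ((A ×ˢ (A ×ˢ A)).filter fun p =>
      r b p.2.1 ∧ r p.1 p.2.1 ∧ r b' p.2.2 ∧ r p.1 p.2.2) Y (fun p => p.1) (t₁ * t₁) (by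
      intro y hy
      rw [hY, Finset.mem_filter] at hy
      calc t₁ * t₁ ≤ (cod b y : ℝ) * cod b' y := by gcongr; exacts [hy.2.1, hy.2.2]
        _ ≤ _ := by
          rw [← Nat.cast_mul, Nat.cast_le, hcod, codegree, codegree, ← Finset.card_product]
          refine Finset.card_le_card_of_injOn (fun p => (y, p)) ?_ ?_
          · intro p hp
            simp only [Finset.coe_product, Finset.coe_filter, Set.mem_prod, Set.mem_ofPred_eq,
              Finset.mem_product, Finset.mem_filter] at hp ⊢
            exact ⟨⟨⟨hSA hy.1, hp.1.1, hp.2.1⟩, hp.1.2.1, hp.1.2.2, hp.2.2.1, hp.2.2.2⟩, trivial⟩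
          · intro p _ p' _ h
            simpa using h)
    refine le_trans ?_ h1
    calc _ ≤ s * δ ^ 4 * N ^ 2 / 2 ^ 21 := by gcongr
      _ = s / 2 * (t₁ * t₁) := by rw [ht₁]; ring
      _ ≤ _ := by gcongr
  · intro b hb w hw
    rw [hW, Finset.mem_filter] at hw
    set Y := (S v).filter fun y => r y w ∧ t₂ ≤ cod b y with hY
    have hYc : δ * s / 16 ≤ Y.card := by
      have h1 : (S v).filter (fun y => r y w) ⊆ Y ∪ (S v).filter (fun y => (cod b y : ℝ) < t₂) := by
        intro y hy
        simp only [hY, Finset.mem_union, Finset.mem_filter] at hy ⊢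
        by_cases c1 : (cod b y : ℝ) < t₂
        · right; exact ⟨hy.1, c1⟩
        left; exact ⟨hy.1, hy.2, not_lt.1 c1⟩
      have h2 : (((S v).filter (fun y => r y w)).card : ℝ) ≤ Y.card + bd t₂ b := by
        refine (Nat.cast_le.2 (Finset.card_le_card h1)).trans ?_
        refine (Nat.cast_le.2 (Finset.card_union_le _ _)).trans ?_
        rw [Nat.cast_add]
      linarith [(hBbd b hb).2, hw.2]
    have h1 := card_mul_le_card_of_fiber_le ((A ×ˢ A).filter fun p =>
      r b p.2 ∧ r p.1 p.2 ∧ r p.1 w) Y (fun p => p.1) t₂ (by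
      intro y hy
      rw [hY, Finset.mem_filter] at hy
      refine hy.2.2.trans ?_
      rw [Nat.cast_le, hcod, codegree]
      refine Finset.card_le_card_of_injOn (fun p => (y, p)) ?_ ?_
      · intro p hp
        simp only [Finset.coe_filter, Set.mem_ofPred_eq,
          Finset.mem_product, Finset.mem_filter] at hp ⊢
        exact ⟨⟨⟨hSA hy.1, hp.1⟩, hp.2.1, hp.2.2, hy.2.1⟩, trivial⟩
      · intro p _ p' _ h
        simpa using h)
    refine le_trans ?_ h1
    calc _ ≤ s * δ ^ 4 * N / 2 ^ 14 := by gcongr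
      _ = δ * s / 16 * t₂ := by rw [ht₂]; ring
      _ ≤ _ := by gcongr

theorem card_sub_mul_le_of_paths {G : Type*} [AddCommGroup G] [DecidableEq G]
    (A B D : Finset G) (m : ℝ)
    (h : ∀ b ∈ B, ∀ b' ∈ B, m ≤ ((A ×ˢ (A ×ˢ A)).filter fun p =>
      b - p.2.1 ∈ D ∧ p.1 - p.2.1 ∈ D ∧ b' - p.2.2 ∈ D ∧ p.1 - p.2.2 ∈ D).card) :
    ((B - B).card : ℝ) * m ≤ (D.card : ℝ) ^ 4 := by
  have h1 := card_mul_le_card_of_fiber_le (D ×ˢ (D ×ˢ (D ×ˢ D))) (B - B)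
    (fun d => d.1 - d.2.1 + d.2.2.1 - d.2.2.2) m (by
      intro x hx
      obtain ⟨b, hb, b', hb', rfl⟩ := Finset.mem_sub.1 hx
      refine (h b hb b' hb').trans ?_
      norm_cast
      refine Finset.card_le_card_of_injOn
        (fun p => (b - p.2.1, p.1 - p.2.1, p.1 - p.2.2, b' - p.2.2)) ?_ ?_
      · intro p hp
        simp only [Finset.coe_filter, Set.mem_ofPred_eq, Finset.mem_product] at hp ⊢
        exact ⟨⟨hp.2.1, hp.2.2.1, hp.2.2.2.2, hp.2.2.2.1⟩, by abel⟩
      · rintro ⟨y, x, z⟩ _ ⟨y', x', z'⟩ _ e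
        simp only [Prod.mk.injEq, sub_right_inj] at e ⊢
        obtain ⟨rfl, e2, -, rfl⟩ := e
        exact ⟨by simpa using e2, rfl, rfl⟩)
  refine h1.trans (le_of_eq ?_)
  simp only [Finset.card_product]; push_cast; ring

theorem card_sub_mul_le_of_short_paths {G : Type*} [AddCommGroup G] [DecidableEq G]
    (A B W D : Finset G) (m : ℝ)
    (h : ∀ b ∈ B, ∀ w ∈ W, m ≤ ((A ×ˢ A).filter fun p =>
      b - p.2 ∈ D ∧ p.1 - p.2 ∈ D ∧ p.1 - w ∈ D).card) :
    ((B - W).card : ℝ) * m ≤ (D.card : ℝ) ^ 3 := by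
  have h1 := card_mul_le_card_of_fiber_le (D ×ˢ (D ×ˢ D)) (B - W)
    (fun d => d.1 - d.2.1 + d.2.2) m (by
      intro x hx
      obtain ⟨b, hb, w, hw, rfl⟩ := Finset.mem_sub.1 hx
      refine (h b hb w hw).trans ?_
      norm_cast
      refine Finset.card_le_card_of_injOn (fun p => (b - p.2, p.1 - p.2, p.1 - w)) ?_ ?_
      · intro p hp
        simp only [Finset.coe_filter, Set.mem_ofPred_eq, Finset.mem_product] at hp ⊢
        exact ⟨⟨hp.2.1, hp.2.2.1, hp.2.2.2⟩, by abel⟩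
      · rintro ⟨y, x⟩ _ ⟨y', x'⟩ _ e
        simp only [Prod.mk.injEq, sub_right_inj, sub_left_inj] at e ⊢
        exact ⟨e.2.2, e.1⟩)
  refine h1.trans (le_of_eq ?_)
  simp only [Finset.card_product]; push_cast; ring

theorem popular_card_bound {D e ℓ K N E : ℝ} (hD0 : 0 ≤ D) (hK : 0 < K) (hN : 0 < N)
    (hD : D * E ≤ 2 * ℓ * e ^ 2) (hE : N ^ 3 ≤ K * E) :
    D ≤ 2 * ℓ * K * (e / N ^ 2) ^ 2 * N := by
  have h1 : D * N ^ 3 ≤ (2 * ℓ * K * (e / N ^ 2) ^ 2 * N) * N ^ 3 := by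
    calc D * N ^ 3 ≤ D * (K * E) := by gcongr
      _ = K * (D * E) := by ring
      _ ≤ K * (2 * ℓ * e ^ 2) := by gcongr
      _ = _ := by field_simp
  exact le_of_mul_le_mul_right h1 (by positivity)

theorem difference_card_bound {D b ℓ K N δ M : ℝ} (hD0 : 0 ≤ D) (hb : 0 < b) (hℓ : 0 < ℓ)
    (hK : 0 < K) (hN : 0 < N) (hδ : 0 < δ) (hδb : δ * N ≤ 6 * b)
    (hD : D ≤ 2 * ℓ * K * δ ^ 2 * N) (h : M * (b * δ ^ 4 * N ^ 2 / 2 ^ 21) ≤ D ^ 4) :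
    M * N ^ 2 ≤ 2 ^ 36 * ℓ ^ 4 * K ^ 4 * b ^ 3 := by
  have h2 : D ^ 4 ≤ (2 * ℓ * K * δ ^ 2 * N) ^ 4 := by gcongr
  have h3 : M * N ^ 2 * (b * δ ^ 4 * N ^ 2) ≤
      2 ^ 36 * ℓ ^ 4 * K ^ 4 * b ^ 3 * (b * δ ^ 4 * N ^ 2) := by
    calc M * N ^ 2 * (b * δ ^ 4 * N ^ 2)
        = 2 ^ 21 * N ^ 2 * (M * (b * δ ^ 4 * N ^ 2 / 2 ^ 21)) := by ring
      _ ≤ 2 ^ 21 * N ^ 2 * (2 * ℓ * K * δ ^ 2 * N) ^ 4 := by gcongr; exact h.trans h2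
      _ = 2 ^ 25 * ℓ ^ 4 * K ^ 4 * δ ^ 4 * N ^ 2 * (δ * N) ^ 4 := by ring
      _ ≤ 2 ^ 25 * ℓ ^ 4 * K ^ 4 * δ ^ 4 * N ^ 2 * (6 * b) ^ 4 := by gcongr
      _ = (2 ^ 25 * 6 ^ 4) * (ℓ ^ 4 * K ^ 4 * b ^ 3 * (b * δ ^ 4 * N ^ 2)) := by ring
      _ ≤ 2 ^ 36 * (ℓ ^ 4 * K ^ 4 * b ^ 3 * (b * δ ^ 4 * N ^ 2)) := by
        gcongr; norm_num
      _ = _ := by ring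
  exact le_of_mul_le_mul_right h3 (by positivity)

theorem double_difference_card_bound {D b ℓ K N δ M w Q : ℝ} (hD0 : 0 ≤ D) (hb : 0 < b)
    (hℓ : 0 < ℓ) (hK : 0 < K) (hN : 0 < N) (hδ : 0 < δ) (hM : 0 ≤ M) (hQ : 0 ≤ Q)
    (hδb : δ * N ≤ 6 * b) (hw : δ * N / 4 ≤ w) (hD : D ≤ 2 * ℓ * K * δ ^ 2 * N)
    (h : M * (b * δ ^ 4 * N / 2 ^ 14) ≤ D ^ 3) (h4 : Q ≤ (M / w) ^ 4 * w) :
    Q ≤ 2 ^ 87 * ℓ ^ 12 * K ^ 12 * b := by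
  have hw0 : 0 < w := lt_of_lt_of_le (by positivity) hw
  have h2 : D ^ 3 ≤ (2 * ℓ * K * δ ^ 2 * N) ^ 3 := by gcongr
  have h3 : M * b ≤ 2 ^ 17 * ℓ ^ 3 * K ^ 3 * (δ * N) ^ 2 := by
    have : M * b * (δ ^ 4 * N) ≤ 2 ^ 17 * ℓ ^ 3 * K ^ 3 * (δ * N) ^ 2 * (δ ^ 4 * N) := by
      calc M * b * (δ ^ 4 * N) = 2 ^ 14 * (M * (b * δ ^ 4 * N / 2 ^ 14)) := by ring
        _ ≤ 2 ^ 14 * (2 * ℓ * K * δ ^ 2 * N) ^ 3 := by gcongr; exact h.trans h2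
        _ = _ := by ring
    exact le_of_mul_le_mul_right this (by positivity)
  have h4' : Q * w ^ 3 ≤ M ^ 4 := by
    calc Q * w ^ 3 ≤ (M / w) ^ 4 * w * w ^ 3 := by gcongr
      _ = _ := by field_simp
  have h5 : Q * ((δ * N) ^ 3 * b ^ 4) ≤
      2 ^ 87 * ℓ ^ 12 * K ^ 12 * b * ((δ * N) ^ 3 * b ^ 4) := by
    calc Q * ((δ * N) ^ 3 * b ^ 4) = 2 ^ 6 * (Q * (δ * N / 4) ^ 3) * b ^ 4 := by ring
      _ ≤ 2 ^ 6 * (Q * w ^ 3) * b ^ 4 := by gcongr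
      _ ≤ 2 ^ 6 * M ^ 4 * b ^ 4 := by gcongr
      _ = 2 ^ 6 * (M * b) ^ 4 := by ring
      _ ≤ 2 ^ 6 * (2 ^ 17 * ℓ ^ 3 * K ^ 3 * (δ * N) ^ 2) ^ 4 := by gcongr
      _ = 2 ^ 74 * ℓ ^ 12 * K ^ 12 * (δ * N) ^ 3 * (δ * N) ^ 5 := by ring
      _ ≤ 2 ^ 74 * ℓ ^ 12 * K ^ 12 * (δ * N) ^ 3 * (6 * b) ^ 5 := by gcongr
      _ = (2 ^ 74 * 6 ^ 5) * (ℓ ^ 12 * K ^ 12 * b * ((δ * N) ^ 3 * b ^ 4)) := by ring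
      _ ≤ 2 ^ 87 * (ℓ ^ 12 * K ^ 12 * b * ((δ * N) ^ 3 * b ^ 4)) := by
        gcongr; norm_num
      _ = _ := by ring
  exact le_of_mul_le_mul_right h5 (by positivity)

/-- Balog–Szemerédi–Gowers with the sharp dependence `|B - B| ≪ K⁴ |B|³ / N²`, and the bound
`|2B - 2B| ≪ K¹² |B|` coming from an auxiliary set `W` with `|B - W| ≪ K³ |W|`. -/
theorem exists_subset_small_doubling {G : Type*} [AddCommGroup G] [DecidableEq G] (A : Finset G)
    (hA : A.Nonempty) (N K ℓ : ℝ) (hN : (A.card : ℝ) ≤ N) (hK : 0 < K)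
    (hE : N ^ 3 ≤ K * collisions (A ×ˢ A) (fun t : G × G => t.1 - t.2))
    (hℓ : ((Nat.log 2 A.card + 1 : ℕ) : ℝ) ≤ ℓ) :
    ∃ B ⊆ A, B.Nonempty ∧
      ((B - B).card : ℝ) * N ^ 2 ≤ 2 ^ 36 * ℓ ^ 4 * K ^ 4 * (B.card : ℝ) ^ 3 ∧
      ((2 • B - 2 • B).card : ℝ) ≤ 2 ^ 87 * ℓ ^ 12 * K ^ 12 * B.card := by
  have hN0 : 0 < N := lt_of_lt_of_le (by exact_mod_cast hA.card_pos) hN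
  have hℓ0 : 0 < ℓ := lt_of_lt_of_le (Nat.cast_pos.2 (Nat.succ_pos _)) hℓ
  obtain ⟨D, he0, hD⟩ := exists_popular_differences A hA
  obtain ⟨e, he⟩ : ∃ e : ℝ, e = (((A ×ˢ A).filter fun t => t.1 - t.2 ∈ D).card : ℝ) := ⟨_, rfl⟩
  have he0' : 0 < e := by rw [he]; exact Nat.cast_pos.2 he0
  have hD' : (D.card : ℝ) * collisions (A ×ˢ A) (fun t : G × G => t.1 - t.2) ≤
      2 * ℓ * e ^ 2 := by
    refine le_trans (b := 2 * ((Nat.log 2 A.card + 1 : ℕ) : ℝ) * e ^ 2) ?_ ?_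
    · rw [he]; exact_mod_cast hD
    · exact mul_le_mul_of_nonneg_right (by linarith) (sq_nonneg _)
  have hDc := popular_card_bound (Nat.cast_nonneg _) hK hN0 hD' hE
  obtain ⟨δ, hδ⟩ : ∃ δ : ℝ, δ = e / N ^ 2 := ⟨_, rfl⟩
  rw [← hδ] at hDc
  have hδ0 : 0 < δ := by rw [hδ]; positivity
  have heδ : δ * N ^ 2 = e := by rw [hδ]; field_simp
  obtain ⟨B, hBA, W, hWA, hBc, hWc, hp4, hp3⟩ := exists_subset_many_paths A
    (fun a b => a - b ∈ D) N δ hN hN0 hδ0 (by rw [heδ, he])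
  have hb0 : 0 < (B.card : ℝ) := lt_of_lt_of_le (by positivity) hBc
  have hBne : B.Nonempty := Finset.card_pos.1 (Nat.cast_pos.1 hb0)
  have hWpos : 0 < (W.card : ℝ) := lt_of_lt_of_le (by positivity) hWc
  have hWne : W.Nonempty := Finset.card_pos.1 (Nat.cast_pos.1 hWpos)
  have hδb : δ * N ≤ 6 * (B.card : ℝ) := by linarith
  refine ⟨B, hBA, hBne, ?_, ?_⟩
  · exact difference_card_bound (Nat.cast_nonneg _) hb0 hℓ0 hK hN0 hδ0 hδb hDc
      (card_sub_mul_le_of_paths A B D _ hp4)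
  · refine double_difference_card_bound (Nat.cast_nonneg _) hb0 hℓ0 hK hN0 hδ0 (Nat.cast_nonneg _)
      (Nat.cast_nonneg _) hδb hWc hDc (card_sub_mul_le_of_short_paths A B W D _ hp3) ?_
    have hpl := Finset.pluennecke_ruzsa_inequality_nsmul_sub_nsmul_add
      (A := -W) (by simpa using hWne) B 2 2
    rw [neg_add_eq_sub, Finset.card_neg] at hpl
    have hpl' := (NNRat.cast_le (K := ℝ)).2 hpl
    simpa using hpl'

theorem exists_translate_large_inter {G : Type*} [AddCommGroup G] [DecidableEq G]
    (W' W Z : Finset G) (hW : W' ⊆ W) (hne : (W' ×ˢ Z).Nonempty) :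
    ∃ t ∈ W - Z, W'.card * Z.card ≤ (W - Z).card * (W'.filter fun w => w - t ∈ Z).card := by
  by_contra! hcon
  have hfib : (W' ×ˢ Z).card =
      ∑ t ∈ W - Z, ((W' ×ˢ Z).filter fun p => p.1 - p.2 = t).card := by
    refine Finset.card_eq_sum_card_fiberwise fun p hp => ?_
    rw [Finset.mem_coe, Finset.mem_product] at hp
    exact Finset.mem_coe.2 (Finset.sub_mem_sub (hW hp.1) hp.2)
  have hle : ∀ t, ((W' ×ˢ Z).filter fun p => p.1 - p.2 = t).card ≤
      (W'.filter fun w => w - t ∈ Z).card := by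
    intro t
    refine Finset.card_le_card_of_injOn (fun p => p.1) ?_ ?_
    · rintro ⟨a, b⟩ hp
      simp only [Finset.coe_filter, Set.mem_ofPred_eq, Finset.mem_product] at hp ⊢
      obtain ⟨⟨h1, h2⟩, rfl⟩ := hp
      exact ⟨h1, by simpa using h2⟩
    · rintro ⟨a, b⟩ h ⟨a', b'⟩ h' e
      simp only [Finset.coe_filter, Finset.mem_product, Set.mem_ofPred_eq] at h h' e
      subst e
      rw [← h'.2] at h
      simpa using h.2
  obtain ⟨⟨w, z⟩, hwz⟩ := hne
  rw [Finset.mem_product] at hwz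
  have hne' : (W - Z).Nonempty := ⟨w - z, Finset.sub_mem_sub (hW hwz.1) hwz.2⟩
  have h1 := Finset.sum_lt_sum_of_nonempty hne' hcon
  rw [Finset.sum_const, smul_eq_mul, ← Finset.mul_sum] at h1
  have h2 := Nat.lt_of_mul_lt_mul_left h1
  rw [← Finset.card_product, hfib] at h2
  exact absurd (Finset.sum_le_sum fun t (_ : t ∈ W - Z) => hle t) (not_le.2 h2)

/-- Most of `W` is covered by few translates of `Z`. -/
theorem exists_translates_cover {G : Type*} [AddCommGroup G] [DecidableEq G]
    (W Z : Finset G) (hZ : Z.Nonempty) :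
    ∃ T W₀ : Finset G, W₀ ⊆ W ∧ (∀ w ∈ W₀, ∃ t ∈ T, w - t ∈ Z) ∧ 3 * W.card ≤ 4 * W₀.card ∧
      T.card * Z.card ≤ 4 * (W - Z).card := by
  rcases W.eq_empty_or_nonempty with rfl | hW
  · exact ⟨∅, ∅, by simp, by simp, by simp, by simp⟩
  let cov : Finset G → Finset G := fun T => W.filter fun w => ∃ t ∈ T, w - t ∈ Z
  let good : Finset (Finset G) := (W - Z).powerset.filter fun T =>
    T.card * (W.card * Z.card) ≤ 4 * (W - Z).card * (cov T).card
  obtain ⟨T, hT, hmax⟩ := Finset.exists_max_image good Finset.card ⟨∅, by simp [good]⟩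
  simp only [good, Finset.mem_filter, Finset.mem_powerset] at hT
  have hWpos := hW.card_pos
  refine ⟨T, cov T, Finset.filter_subset _ _, fun w hw => (Finset.mem_filter.1 hw).2, ?_, ?_⟩
  · by_contra hlt
    have hcovW : cov T ⊆ W := Finset.filter_subset _ _
    have hsd : (W \ cov T).card + (cov T).card = W.card :=
      Finset.card_sdiff_add_card_eq_card hcovW
    have h4 : W.card < 4 * (W \ cov T).card := by omega
    have hne : (W \ cov T).Nonempty := Finset.card_pos.1 (by omega)
    obtain ⟨t, ht, hle⟩ := exists_translate_large_inter (W \ cov T) W Z Finset.sdiff_subset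
      (hne.product hZ)
    have hpos : 0 < ((W \ cov T).filter fun w => w - t ∈ Z).card := by
      by_contra h0
      have : ((W \ cov T).filter fun w => w - t ∈ Z).card = 0 := by omega
      rw [this, mul_zero] at hle
      have := Nat.mul_pos hne.card_pos hZ.card_pos
      omega
    have htT : t ∉ T := by
      intro htT
      obtain ⟨w, hw⟩ := Finset.card_pos.1 hpos
      rw [Finset.mem_filter, Finset.mem_sdiff] at hw
      exact hw.1.2 (Finset.mem_filter.2 ⟨hw.1.1, t, htT, hw.2⟩)
    have hsub : cov T ∪ ((W \ cov T).filter fun w => w - t ∈ Z) ⊆ cov (insert t T) := by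
      intro w hw
      simp only [cov, Finset.mem_union, Finset.mem_filter, Finset.mem_sdiff] at hw ⊢
      rcases hw with ⟨h1, s, hs, h2⟩ | ⟨h1, h2⟩
      · exact ⟨h1, s, Finset.mem_insert_of_mem hs, h2⟩
      · exact ⟨h1.1, t, Finset.mem_insert_self _ _, h2⟩
    have hcard : (cov T).card + ((W \ cov T).filter fun w => w - t ∈ Z).card ≤
        (cov (insert t T)).card := by
      rw [← Finset.card_union_of_disjoint]
      · exact Finset.card_le_card hsub
      · rw [Finset.disjoint_left]
        intro w hw hw'
        exact (Finset.mem_sdiff.1 (Finset.mem_filter.1 hw').1).2 hw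
    have hgood : insert t T ∈ good := by
      simp only [good, Finset.mem_filter, Finset.mem_powerset]
      refine ⟨Finset.insert_subset ht hT.1, ?_⟩
      rw [Finset.card_insert_of_notMem htT]
      calc (T.card + 1) * (W.card * Z.card)
          ≤ T.card * (W.card * Z.card) + 4 * (W \ cov T).card * Z.card := by
            nlinarith [Nat.mul_le_mul_right Z.card h4.le]
        _ ≤ 4 * (W - Z).card * (cov T).card +
            4 * ((W - Z).card * ((W \ cov T).filter fun w => w - t ∈ Z).card) := by
            have := hT.2; linarith
        _ = 4 * (W - Z).card *
            ((cov T).card + ((W \ cov T).filter fun w => w - t ∈ Z).card) := by ring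
        _ ≤ _ := by gcongr
    have := hmax _ hgood
    rw [Finset.card_insert_of_notMem htT] at this
    omega
  · have h1 : (cov T).card ≤ W.card := Finset.card_filter_le _ _
    have h2 : T.card * Z.card * W.card ≤ 4 * (W - Z).card * W.card := by
      calc _ = T.card * (W.card * Z.card) := by ring
        _ ≤ _ := hT.2
        _ ≤ _ := by gcongr
    exact Nat.le_of_mul_le_mul_right h2 hWpos

theorem le_of_ratio_bounds {P r a x n₁ n₂ : ℚ} (hr : 0 ≤ r) (ha : 0 < a) (hx : 0 < x)
    (hn₁ : 0 < n₁) (hn₂ : 0 < n₂) (h1 : P * (n₁ * n₂) * x ≤ r * r)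
    (h2 : r * a ≤ 2 * (n₁ * n₂) * x) : P * a ^ 2 ≤ 4 * n₂ * n₁ * x := by
  have h3 : P * a ^ 2 * (n₁ * n₂ * x) ≤ 4 * n₂ * n₁ * x * (n₁ * n₂ * x) := by
    calc P * a ^ 2 * (n₁ * n₂ * x) = P * (n₁ * n₂) * x * a ^ 2 := by ring
      _ ≤ r * r * a ^ 2 := by gcongr
      _ = (r * a) ^ 2 := by ring
      _ ≤ (2 * (n₁ * n₂) * x) ^ 2 := by gcongr
      _ = _ := by ring
  exact le_of_mul_le_mul_right h3 (by positivity)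

/-- The Plünnecke inequality for two distinct summands, up to a constant factor. -/
theorem exists_subset_pluennecke_two {G : Type*} [AddCommGroup G] [DecidableEq G]
    (A B₁ B₂ : Finset G) (hA : A.Nonempty) (hB₁ : B₁.Nonempty) (hB₂ : B₂.Nonempty) :
    ∃ X ⊆ A, X.Nonempty ∧
      (X + B₁ + B₂).card * A.card ^ 2 ≤ 4 * (A + B₁).card * (A + B₂).card * X.card := by
  set n₁ := (A + B₂).card with hn₁
  set n₂ := (A + B₁).card with hn₂
  have hn₁0 : 0 < n₁ := (hA.add hB₂).card_pos
  have hn₂0 : 0 < n₂ := (hA.add hB₁).card_pos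
  let emb : Finset G → Finset (G × ℤ × ℤ) := fun X => X ×ˢ {((0 : ℤ), (0 : ℤ))}
  let I : ℕ → Finset ℤ := fun n => (Finset.range n).image (fun k : ℕ => (k : ℤ))
  have hI : ∀ n, (I n).card = n := fun n => by
    rw [Finset.card_image_of_injective _ Nat.cast_injective, Finset.card_range]
  let B' : Finset (G × ℤ × ℤ) := B₁ ×ˢ (I n₁ ×ˢ {0}) ∪ B₂ ×ˢ ({0} ×ˢ I n₂)
  have hemb : ∀ X, (emb X).card = X.card := fun X => by simp [emb]
  have hbound : (emb A + B').card ≤ 2 * (n₁ * n₂) := by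
    have hsub : emb A + B' ⊆ (A + B₁) ×ˢ (I n₁ ×ˢ {0}) ∪ (A + B₂) ×ˢ ({0} ×ˢ I n₂) := by
      intro x hx
      obtain ⟨a, ha, b, hb, rfl⟩ := Finset.mem_add.1 hx
      simp only [emb, B', Finset.mem_product, Finset.mem_union, Finset.mem_singleton] at ha hb ⊢
      obtain ⟨ha1, ha2⟩ := ha
      rcases hb with ⟨h1, h2, h3⟩ | ⟨h1, h2, h3⟩
      · left; exact ⟨Finset.add_mem_add ha1 h1, by simpa [ha2] using h2, by simp [ha2, h3]⟩
      · right; exact ⟨Finset.add_mem_add ha1 h1, by simp [ha2, h2], by simpa [ha2] using h3⟩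
    refine (Finset.card_le_card hsub).trans ((Finset.card_union_le _ _).trans ?_)
    simp only [Finset.card_product, hI, Finset.card_singleton, ← hn₁, ← hn₂]
    nlinarith
  obtain ⟨X, hX, hmin⟩ := Finset.exists_min_image (A.powerset.filter fun X => X.Nonempty)
    (fun X => ((emb X + B').card : ℚ) / X.card) ⟨A, by simp [hA]⟩
  simp only [Finset.mem_filter, Finset.mem_powerset] at hX hmin
  obtain ⟨hXA, hXne⟩ := hX
  have hXpos : (0 : ℚ) < X.card := by exact_mod_cast hXne.card_pos
  have hApos : (0 : ℚ) < A.card := by exact_mod_cast hA.card_pos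
  have hpet := Finset.pluennecke_petridis_inequality_add (A := emb X) (B := B') B' (by
    intro A' hA'
    rcases A'.eq_empty_or_nonempty with rfl | hne
    · simp
    set X' := A'.image Prod.fst with hX'
    have hA'e : A' = emb X' := by
      ext ⟨g, k⟩
      simp only [hX', emb, Finset.mem_product, Finset.mem_image, Finset.mem_singleton]
      constructor
      · intro h
        exact ⟨⟨_, h, rfl⟩, by have := hA' h; simp only [emb, Finset.mem_product,
          Finset.mem_singleton] at this; exact this.2⟩
      · rintro ⟨⟨⟨g', k'⟩, h, rfl⟩, rfl⟩
        have := hA' h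
        simp only [emb, Finset.mem_product, Finset.mem_singleton] at this
        rw [← this.2]; exact h
    have hX'X : X' ⊆ X := by
      intro g hg
      obtain ⟨y, hy, rfl⟩ := Finset.mem_image.1 hg
      exact (Finset.mem_product.1 (hA' hy)).1
    have hX'ne : X'.Nonempty := hne.image _
    have hX'pos : (0 : ℚ) < X'.card := by exact_mod_cast hX'ne.card_pos
    have := hmin X' ⟨hX'X.trans hXA, hX'ne⟩
    rw [div_le_div_iff₀ hXpos hX'pos] at this
    rw [hA'e, hemb, hemb]
    exact_mod_cast this)
  have hratio : ((emb X + B').card : ℚ) * A.card ≤ 2 * (n₁ * n₂) * X.card := by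
    have h1 := hmin A ⟨subset_rfl, hA⟩
    rw [div_le_div_iff₀ hXpos hApos] at h1
    refine h1.trans ?_
    have : ((emb A + B').card : ℚ) ≤ 2 * (n₁ * n₂) := by exact_mod_cast hbound
    gcongr
  have hlow : (X + B₁ + B₂).card * (n₁ * n₂) ≤ (B' + emb X + B').card := by
    have : (X + B₁ + B₂).card * (n₁ * n₂) = ((X + B₁ + B₂) ×ˢ (I n₁ ×ˢ I n₂)).card := by
      simp only [Finset.card_product, hI]
    rw [this]
    refine Finset.card_le_card ?_
    rintro ⟨g, i, j⟩ h
    simp only [Finset.mem_product] at h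
    obtain ⟨hg, hi, hj⟩ := h
    obtain ⟨y, hy, b₂, hb₂, rfl⟩ := Finset.mem_add.1 hg
    obtain ⟨x, hx, b₁, hb₁, rfl⟩ := Finset.mem_add.1 hy
    refine Finset.mem_add.2 ⟨(x + b₁, i, 0), Finset.mem_add.2 ⟨(b₁, i, 0), ?_, (x, 0, 0), ?_, ?_⟩,
      (b₂, 0, j), ?_, ?_⟩
    · simp [B', hb₁, hi]
    · simp [emb, hx]
    · simp [add_comm]
    · simp [B', hb₂, hj]
    · simp
  refine ⟨X, hXA, hXne, ?_⟩
  have h1 : ((X + B₁ + B₂).card : ℚ) * (n₁ * n₂) * X.card ≤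
      (emb X + B').card * (emb X + B').card := by
    rw [hemb, add_comm B' (emb X)] at hpet
    rw [add_comm B' (emb X)] at hlow
    have hlow' : ((X + B₁ + B₂).card : ℚ) * (n₁ * n₂) ≤ (emb X + B' + B').card := by
      exact_mod_cast hlow
    have hpet' : ((emb X + B' + B').card : ℚ) * X.card ≤
      (emb X + B').card * (emb X + B').card := by exact_mod_cast hpet
    refine le_trans ?_ hpet'
    gcongr
  have h3 := le_of_ratio_bounds (Nat.cast_nonneg _) hApos hXpos (Nat.cast_pos.2 hn₁0)
    (Nat.cast_pos.2 hn₂0) h1 hratio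
  exact_mod_cast h3

/-- A symmetric relation with many edges has an induced subgraph whose minimal degree is large
compared with its size, up to a harmonic factor. -/
theorem exists_subset_min_degree {V : Type*} [DecidableEq V] (B : Finset V) (r : V → V → Prop)
    [DecidableRel r] (hr : ∀ a b, r a b → r b a) (H : ℝ)
    (hH : ∑ i ∈ Finset.range B.card, (1 : ℝ) / (i + 1) ≤ H) (hH0 : 0 < H)
    (he : 0 < ((B ×ˢ B).filter fun t => r t.1 t.2).card) :
    ∃ C ⊆ B, C.Nonempty ∧ ∀ c ∈ C, (((B ×ˢ B).filter fun t => r t.1 t.2).card : ℝ) ≤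
      4 * H * C.card * (C.filter fun v => r c v).card := by
  let e : Finset V → ℝ := fun C => (((C ×ˢ C).filter fun t => r t.1 t.2).card : ℝ)
  let h : ℕ → ℝ := fun k => ∑ i ∈ Finset.range k, (1 : ℝ) / (i + 1)
  set κ := e B / (2 * H) with hκ
  have he' : 0 < e B := Nat.cast_pos.2 he
  have hκ0 : 0 < κ := by positivity
  obtain ⟨C, hC, hmax⟩ := Finset.exists_max_image B.powerset (fun C => e C - κ * h C.card)
    ⟨B, by simp⟩
  rw [Finset.mem_powerset] at hC
  have hCB : 0 < e C - κ * h C.card := by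
    refine lt_of_lt_of_le ?_ (hmax B (by simp))
    have : κ * h B.card ≤ κ * H := by gcongr
    have e1 : κ * H = e B / 2 := by rw [hκ]; field_simp
    linarith
  have hCne : C.Nonempty := by
    by_contra hne
    rw [Finset.not_nonempty_iff_eq_empty] at hne
    rw [hne] at hCB
    simp [e, h] at hCB
  refine ⟨C, hC, hCne, fun c hc => ?_⟩
  have h1 := hmax (C.erase c) (by
    rw [Finset.mem_powerset]; exact (Finset.erase_subset _ _).trans hC)
  have h2 : e C ≤ e (C.erase c) + 2 * (C.filter fun v => r c v).card := by
    have hsub : (C ×ˢ C).filter (fun t => r t.1 t.2) ⊆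
        ((C.erase c ×ˢ C.erase c).filter fun t => r t.1 t.2) ∪
        ((C.filter fun v => r c v).image (fun v => (c, v)) ∪
          (C.filter fun v => r c v).image (fun v => (v, c))) := by
      rintro ⟨a, b⟩ hab
      simp only [Finset.mem_filter, Finset.mem_product] at hab
      obtain ⟨⟨ha, hb⟩, hab⟩ := hab
      simp only [Finset.mem_union, Finset.mem_filter, Finset.mem_product, Finset.mem_erase,
        Finset.mem_image, Prod.mk.injEq]
      by_cases h1 : a = c
      · right; left; exact ⟨b, ⟨hb, h1 ▸ hab⟩, h1.symm, rfl⟩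
      by_cases h2 : b = c
      · right; right; exact ⟨a, ⟨ha, hr _ _ (h2 ▸ hab)⟩, rfl, h2.symm⟩
      left; exact ⟨⟨⟨h1, ha⟩, h2, hb⟩, hab⟩
    have hc1 := (Finset.card_le_card hsub).trans ((Finset.card_union_le _ _).trans
      (Nat.add_le_add_left ((Finset.card_union_le _ _).trans
        (Nat.add_le_add Finset.card_image_le Finset.card_image_le)) _))
    have hc2 : (((C ×ˢ C).filter fun t => r t.1 t.2).card : ℝ) ≤
        ((C.erase c ×ˢ C.erase c).filter fun t => r t.1 t.2).card +
        ((C.filter fun v => r c v).card + (C.filter fun v => r c v).card) := by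
      exact_mod_cast hc1
    simp only [e]
    linarith
  have hcard : C.card = (C.erase c).card + 1 := (Finset.card_erase_add_one hc).symm
  have h3 : h C.card = h (C.erase c).card + 1 / C.card := by
    simp only [h]
    rw [hcard, Finset.sum_range_succ]
    push_cast; ring
  have hCpos : (0 : ℝ) < C.card := Nat.cast_pos.2 hCne.card_pos
  have h4 : κ / C.card ≤ 2 * (C.filter fun v => r c v).card := by
    have : κ * h C.card = κ * h (C.erase c).card + κ / C.card := by rw [h3]; ring
    linarith
  calc e B = 2 * H * C.card * (κ / C.card) := by rw [hκ]; field_simp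
    _ ≤ 2 * H * C.card * (2 * (C.filter fun v => r c v).card) :=
        mul_le_mul_of_nonneg_left h4 (by positivity)
    _ = _ := by ring

theorem exists_many_pairs_mul {F : Type*} [Field F] [DecidableEq F] (B : Finset F)
    (hB : (0 : F) ∉ B) (hne : B.Nonempty) :
    ∃ x₀ ∈ B, collisions (B ×ˢ B) (fun t : F × F => t.1 * t.2) ≤
      B.card * ((B ×ˢ B).filter fun t => t.1 * t.2 / x₀ ∈ B).card := by
  by_contra! hcon
  have h1 := Finset.sum_lt_sum_of_nonempty hne hcon
  rw [Finset.sum_const, smul_eq_mul, ← Finset.mul_sum] at h1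
  have h2 := Nat.lt_of_mul_lt_mul_left h1
  refine absurd h2 (not_lt.2 ?_)
  unfold collisions
  rw [Finset.card_eq_sum_card_fiberwise (f := fun t => t.2.1) (t := B) (fun t ht => by
    have := (Finset.mem_filter.1 (Finset.mem_coe.1 ht)).1
    simp only [Finset.mem_product] at this
    exact Finset.mem_coe.2 this.2.1)]
  refine Finset.sum_le_sum fun x hx => ?_
  have hx0 : x ≠ 0 := fun h => hB (h ▸ hx)
  refine Finset.card_le_card_of_injOn (fun t => t.1) ?_ ?_
  · rintro ⟨⟨a, b⟩, c, d⟩ h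
    simp only [Finset.coe_filter, Finset.mem_filter, Finset.mem_product, Set.mem_ofPred_eq] at h ⊢
    obtain ⟨⟨⟨h1, h2⟩, h3⟩, rfl⟩ := h
    refine ⟨h1, ?_⟩
    rw [h3, mul_div_cancel_left₀ _ hx0]; exact h2.2
  · rintro ⟨⟨a, b⟩, c, d⟩ h ⟨⟨a', b'⟩, c', d'⟩ h' e
    simp only [Finset.coe_filter, Finset.mem_filter, Finset.mem_product, Set.mem_ofPred_eq,
      Prod.mk.injEq] at h h' e ⊢
    obtain ⟨⟨-, h3⟩, rfl⟩ := h
    obtain ⟨⟨-, h3'⟩, rfl⟩ := h'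
    obtain ⟨rfl, rfl⟩ := e
    exact ⟨⟨rfl, rfl⟩, rfl, mul_left_cancel₀ hx0 (h3.symm.trans h3')⟩

section Covers

variable {F : Type*} [Field F] [DecidableEq F]

theorem exists_cover_dilate (B W Z : Finset F) (a : F) (τ : ℕ) (hτ : 0 < τ) (hZB : Z ⊆ B)
    (hWB : W ⊆ B) (hZ : ∀ z ∈ Z, a * z ∈ B) (hτZ : τ ≤ Z.card) :
    ∃ T W₀ : Finset F, W₀ ⊆ W ∧ 3 * W.card ≤ 4 * W₀.card ∧ T.card * τ ≤ 4 * (B - B).card ∧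
      ∀ w ∈ W₀, ∃ t ∈ T, a * w - t ∈ B := by
  obtain ⟨T, W₀, h1, h2, h3, h4⟩ := exists_translates_cover W Z
    (Finset.card_pos.1 (hτ.trans_le hτZ))
  refine ⟨T.image fun t => a * t, W₀, h1, h3, ?_, ?_⟩
  · calc _ ≤ T.card * Z.card := Nat.mul_le_mul Finset.card_image_le hτZ
      _ ≤ 4 * (W - Z).card := h4
      _ ≤ _ := by gcongr
  · intro w hw
    obtain ⟨t, ht, hwt⟩ := h2 w hw
    refine ⟨a * t, Finset.mem_image_of_mem _ ht, ?_⟩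
    rw [← mul_sub]; exact hZ _ hwt

/-- Covering `(a - b) W` when both `a` and `b` have many multiples in `B`. -/
theorem exists_cover_sub (B W Z₁ Z₂ : Finset F) (a b : F) (τ : ℕ) (hτ : 0 < τ)
    (hWB : W ⊆ B) (hZB₁ : Z₁ ⊆ B) (hZ₁ : ∀ z ∈ Z₁, a * z ∈ B) (hτ₁ : τ ≤ Z₁.card)
    (hZB₂ : Z₂ ⊆ B) (hZ₂ : ∀ z ∈ Z₂, b * z ∈ B) (hτ₂ : τ ≤ Z₂.card) :
    ∃ S W₀ : Finset F, W₀ ⊆ W ∧ W.card ≤ 2 * W₀.card ∧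
      S.card * τ ^ 2 ≤ 16 * (B - B).card ^ 2 ∧ ∀ w ∈ W₀, ∃ s ∈ S, (a - b) * w - s ∈ B - B := by
  obtain ⟨T₁, W₁, h1, h2, h3, h4⟩ := exists_cover_dilate B W Z₁ a τ hτ hZB₁ hWB hZ₁ hτ₁
  obtain ⟨T₂, W₂, k1, k2, k3, k4⟩ :=
    exists_cover_dilate B W₁ Z₂ b τ hτ hZB₂ (h1.trans hWB) hZ₂ hτ₂
  refine ⟨T₁ - T₂, W₂, k1.trans h1, by omega, ?_, ?_⟩
  · calc (T₁ - T₂).card * τ ^ 2 ≤ T₁.card * T₂.card * τ ^ 2 := by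
          gcongr; exact Finset.card_sub_le
      _ = (T₁.card * τ) * (T₂.card * τ) := by ring
      _ ≤ (4 * (B - B).card) * (4 * (B - B).card) := by gcongr
      _ = _ := by ring
  · intro w hw
    obtain ⟨t₁, ht₁, e₁⟩ := h4 w (k1 hw)
    obtain ⟨t₂, ht₂, e₂⟩ := k4 w hw
    refine ⟨t₁ - t₂, Finset.sub_mem_sub ht₁ ht₂, ?_⟩
    have : (a - b) * w - (t₁ - t₂) = (a * w - t₁) - (b * w - t₂) := by ring
    rw [this]; exact Finset.sub_mem_sub e₁ e₂

/-- Covering `(a - b) W` when `a W ⊆ B` already. -/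
theorem exists_cover_sub_of_mul_mem (B W Z : Finset F) (a b : F) (τ : ℕ) (hτ : 0 < τ)
    (hWB : W ⊆ B) (hW : ∀ w ∈ W, a * w ∈ B)
    (hZB : Z ⊆ B) (hZ : ∀ z ∈ Z, b * z ∈ B) (hτZ : τ ≤ Z.card) :
    ∃ S W₀ : Finset F, W₀ ⊆ W ∧ 3 * W.card ≤ 4 * W₀.card ∧
      S.card * τ ≤ 4 * (B - B).card ∧ ∀ w ∈ W₀, ∃ s ∈ S, (a - b) * w - s ∈ B - B := by
  obtain ⟨T, W₀, h1, h2, h3, h4⟩ := exists_cover_dilate B W Z b τ hτ hZB hWB hZ hτZ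
  refine ⟨-T, W₀, h1, h2, by rwa [Finset.card_neg], fun w hw => ?_⟩
  obtain ⟨t, ht, e⟩ := h4 w hw
  refine ⟨-t, by simpa using ht, ?_⟩
  have : (a - b) * w - -t = a * w - (b * w - t) := by ring
  rw [this]; exact Finset.sub_mem_sub (hW _ (h1 hw)) e

theorem card_add_dilate_le (B U V S₁ S₂ : Finset F) (p q : F) (hp : p ≠ 0)
    (hU : ∀ u ∈ U, ∃ s ∈ S₁, p * u - s ∈ B - B) (hV : ∀ v ∈ V, ∃ s ∈ S₂, q * v - s ∈ B - B) :
    (U + V.image (q / p * ·)).card ≤ S₁.card * S₂.card * (2 • B - 2 • B).card := by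
  calc (U + V.image (q / p * ·)).card = ((U + V.image (q / p * ·)).image (p * ·)).card :=
        (Finset.card_image_of_injective _ (mul_right_injective₀ hp)).symm
    _ ≤ ((S₁ + S₂) + (2 • B - 2 • B)).card := by
        refine Finset.card_le_card fun x hx => ?_
        obtain ⟨y, hy, rfl⟩ := Finset.mem_image.1 hx
        obtain ⟨u, hu, w, hw, rfl⟩ := Finset.mem_add.1 hy
        obtain ⟨v, hv, rfl⟩ := Finset.mem_image.1 hw
        obtain ⟨s₁, hs₁, e₁⟩ := hU u hu
        obtain ⟨s₂, hs₂, e₂⟩ := hV v hv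
        obtain ⟨b₁, hb₁, b₂, hb₂, h₁⟩ := Finset.mem_sub.1 e₁
        obtain ⟨b₃, hb₃, b₄, hb₄, h₂⟩ := Finset.mem_sub.1 e₂
        refine Finset.mem_add.2 ⟨s₁ + s₂, Finset.add_mem_add hs₁ hs₂, b₁ + b₃ - (b₂ + b₄), ?_, ?_⟩
        · rw [two_nsmul]
          exact Finset.sub_mem_sub (Finset.add_mem_add hb₁ hb₃) (Finset.add_mem_add hb₂ hb₄)
        · have : p * (u + q / p * v) = p * u + q * v := by field_simp
          show s₁ + s₂ + (b₁ + b₃ - (b₂ + b₄)) = p * (u + q / p * v)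
          rw [this]
          linear_combination h₁ + h₂
    _ ≤ (S₁ + S₂).card * (2 • B - 2 • B).card := Finset.card_add_le
    _ ≤ _ := by gcongr; exact Finset.card_add_le

/-- The set of quotients of differences of elements of `C`. -/
def quotientSet (C : Finset F) : Set F :=
  {r | ∃ a ∈ C, ∃ b ∈ C, ∃ c ∈ C, ∃ d ∈ C, c ≠ d ∧ r = (a - b) / (c - d)}

theorem card_mul_card_le_of_notMem_quotientSet (C U V : Finset F) (hU : U ⊆ C) (hV : V ⊆ C)
    (ξ : F) (hξ : ξ ∉ quotientSet C) : U.card * V.card ≤ (U + V.image (ξ * ·)).card := by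
  rw [← Finset.card_product]
  refine Finset.card_le_card_of_injOn (fun t => t.1 + ξ * t.2) ?_ ?_
  · intro t ht
    rw [Finset.mem_coe, Finset.mem_product] at ht
    exact Finset.mem_coe.2 (Finset.add_mem_add ht.1 (Finset.mem_image_of_mem _ ht.2))
  · rintro ⟨u, v⟩ h ⟨u', v'⟩ h' e
    simp only [Finset.coe_product, Set.mem_prod, Finset.mem_coe] at h h' e
    by_cases hv : v = v'
    · subst hv
      simpa using e
    · exfalso
      refine hξ ⟨u', hU h'.1, u, hU h.1, v, hV h.2, v', hV h'.2, hv, ?_⟩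
      rw [eq_div_iff (sub_ne_zero.2 hv)]
      linear_combination e

/-- If `r - 1` is not a quotient of differences, Plünnecke's inequality converts injectivity of
`u + (r - 1) v` into a lower bound for `|U + r V|`. -/
theorem pivot_lower_bound (C U V : Finset F) (hU : U ⊆ C) (hV : V ⊆ C) (hUne : U.Nonempty)
    (hVne : V.Nonempty) (r : F) (hr : r - 1 ∉ quotientSet C) :
    V.card * U.card ^ 2 ≤ 4 * (C - C).card * (U + V.image (r * ·)).card := by
  obtain ⟨X, hXU, hXne, hX⟩ := exists_subset_pluennecke_two U (-V) (V.image (r * ·)) hUne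
    (by simpa using hVne) (hVne.image _)
  have h1 := card_mul_card_le_of_notMem_quotientSet C X V (hXU.trans hU) hV (r - 1) hr
  have h2 : X + V.image ((r - 1) * ·) ⊆ X + -V + V.image (r * ·) := by
    intro y hy
    obtain ⟨x, hx, w, hw, rfl⟩ := Finset.mem_add.1 hy
    obtain ⟨v, hv, rfl⟩ := Finset.mem_image.1 hw
    refine Finset.mem_add.2 ⟨x + -v, Finset.add_mem_add hx (by simpa using hv), r * v,
      Finset.mem_image_of_mem _ hv, ?_⟩
    show x + -v + r * v = x + (r - 1) * v
    ring
  have h3 : (U + -V).card ≤ (C - C).card := by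
    rw [← sub_eq_add_neg]; exact Finset.card_le_card (Finset.sub_subset_sub hU hV)
  refine Nat.le_of_mul_le_mul_right ?_ hXne.card_pos
  calc V.card * U.card ^ 2 * X.card = X.card * V.card * U.card ^ 2 := by ring
    _ ≤ (X + -V + V.image (r * ·)).card * U.card ^ 2 := by
        gcongr; exact h1.trans (Finset.card_le_card h2)
    _ ≤ 4 * (U + -V).card * (U + V.image (r * ·)).card * X.card := hX
    _ ≤ 4 * (C - C).card * (U + V.image (r * ·)).card * X.card := by gcongr

theorem exists_good_dilate (C S : Finset F) (hS : S.Nonempty) :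
    ∃ ξ ∈ S, ∀ U ⊆ C, ∀ V ⊆ C, (U.card * V.card) ^ 2 * S.card ≤
      (U + V.image (ξ * ·)).card * (S.card * C.card ^ 2 + C.card ^ 4) := by
  let en : F → ℕ := fun ξ => collisions (C ×ˢ C) (fun t : F × F => t.1 + ξ * t.2)
  have hsum : ∑ ξ ∈ S, en ξ ≤ S.card * C.card ^ 2 + C.card ^ 4 := by
    have e1 : ∑ ξ ∈ S, en ξ = ∑ t ∈ (C ×ˢ C) ×ˢ (C ×ˢ C),
        (S.filter fun ξ => t.1.1 + ξ * t.1.2 = t.2.1 + ξ * t.2.2).card := by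
      simp only [en, collisions, Finset.card_filter]
      exact Finset.sum_comm
    have e2 : ∀ t ∈ (C ×ˢ C) ×ˢ (C ×ˢ C),
        (S.filter fun ξ => t.1.1 + ξ * t.1.2 = t.2.1 + ξ * t.2.2).card ≤
        (if t.1 = t.2 then S.card else 0) + 1 := by
      intro t _
      by_cases h : t.1 = t.2
      · rw [if_pos h]
        exact (Finset.card_filter_le _ _).trans (Nat.le_succ _)
      · rw [if_neg h, zero_add, Finset.card_le_one]
        intro x hx y hy
        rw [Finset.mem_filter] at hx hy
        by_cases hv : t.1.2 = t.2.2
        · exfalso; apply h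
          refine Prod.ext ?_ hv
          have := hx.2; rw [hv] at this
          exact add_right_cancel this
        · have h1 : (x - y) * (t.1.2 - t.2.2) = 0 := by linear_combination hx.2 - hy.2
          rcases mul_eq_zero.1 h1 with h2 | h2
          · exact sub_eq_zero.1 h2
          · exact absurd (sub_eq_zero.1 h2) hv
    rw [e1]
    refine (Finset.sum_le_sum e2).trans ?_
    rw [Finset.sum_add_distrib]
    refine Nat.add_le_add (le_of_eq ?_) (le_of_eq ?_)
    · rw [Finset.sum_product]
      simp only [Finset.sum_ite_eq]
      rw [Finset.sum_congr rfl fun x hx => if_pos hx, Finset.sum_const, Finset.card_product,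
        smul_eq_mul]
      ring
    · simp only [Finset.sum_const, Finset.card_product, smul_eq_mul]; ring
  obtain ⟨ξ, hξ, hle⟩ : ∃ ξ ∈ S, S.card * en ξ ≤ S.card * C.card ^ 2 + C.card ^ 4 := by
    by_contra! hcon
    have h1 := Finset.sum_lt_sum_of_nonempty hS hcon
    rw [Finset.sum_const, smul_eq_mul, ← Finset.mul_sum] at h1
    exact absurd hsum (not_le.2 (Nat.lt_of_mul_lt_mul_left h1))
  refine ⟨ξ, hξ, fun U hU V hV => ?_⟩
  have h1 : collisions (U ×ˢ V) (fun t : F × F => t.1 + ξ * t.2) ≤ en ξ := by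
    refine Finset.card_le_card (Finset.filter_subset_filter _ ?_)
    exact Finset.product_subset_product (Finset.product_subset_product hU hV)
      (Finset.product_subset_product hU hV)
  have hmaps : ∀ t ∈ U ×ˢ V, t.1 + ξ * t.2 ∈ U + V.image (ξ * ·) := fun t ht => by
    rw [Finset.mem_product] at ht
    exact Finset.add_mem_add ht.1 (Finset.mem_image_of_mem _ ht.2)
  have h2 : (U.card * V.card) ^ 2 ≤ (U + V.image (ξ * ·)).card *
      collisions (U ×ˢ V) (fun t : F × F => t.1 + ξ * t.2) := by
    rw [collisions_eq_sum_sq _ _ (U + V.image (ξ * ·)) hmaps, ← Finset.card_product,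
      Finset.card_eq_sum_card_fiberwise (f := fun t : F × F => t.1 + ξ * t.2)
        (t := U + V.image (ξ * ·)) (fun t ht => Finset.mem_coe.2 (hmaps t (Finset.mem_coe.1 ht)))]
    exact sq_sum_le_card_mul_sum_sq
  calc (U.card * V.card) ^ 2 * S.card ≤ (U + V.image (ξ * ·)).card * en ξ * S.card := by
        gcongr; exact h2.trans (by gcongr)
    _ = (U + V.image (ξ * ·)).card * (S.card * en ξ) := by ring
    _ ≤ _ := by gcongr

end Covers

section Closure

variable {F : Type*} [Field F]

theorem mem_of_injective_mapsTo {α : Type*} [Finite α] (R : Set α) (f : α → α)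
    (hf : Function.Injective f) (hR : ∀ r ∈ R, f r ∈ R) {x : α} (hx : f x ∈ R) : x ∈ R := by
  let g : R → R := fun r => ⟨f r, hR r r.2⟩
  have hg : Function.Injective g := fun a b h => Subtype.ext (hf (congrArg Subtype.val h))
  obtain ⟨y, hy⟩ := Finite.surjective_of_injective hg ⟨f x, hx⟩
  have : (y : α) = x := hf (congrArg Subtype.val hy)
  rw [← this]; exact y.2

/-- A subset of a finite field that contains `0` and is stable under `r ↦ r - 1` and under
multiplication by a set of nonzero elements contains the subring they generate. -/
theorem subring_closure_subset [Finite F] (R S : Set F) (h0 : (0 : F) ∈ R)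
    (hS : (0 : F) ∉ S) (h1 : ∀ r ∈ R, r - 1 ∈ R) (h2 : ∀ s ∈ S, ∀ r ∈ R, s * r ∈ R) :
    (Subring.closure S : Set F) ⊆ R := by
  have h1' : ∀ r ∈ R, r + 1 ∈ R := fun r hr =>
    mem_of_injective_mapsTo R (· - 1) (sub_left_injective) h1 (by simpa using hr)
  let J : AddSubgroup F :=
    { carrier := {j | ∀ r ∈ R, r + j ∈ R}
      add_mem' := fun {a b} ha hb r hr => by rw [← add_assoc]; exact hb _ (ha _ hr)
      zero_mem' := fun r hr => by rwa [add_zero]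
      neg_mem' := fun {a} ha r hr =>
        mem_of_injective_mapsTo R (· + a) (add_left_injective a) ha (by simpa using hr) }
  let H : Submonoid F :=
    { carrier := {h | h ≠ 0 ∧ ∀ r ∈ R, h * r ∈ R}
      mul_mem' := fun {a b} ha hb =>
        ⟨mul_ne_zero ha.1 hb.1, fun r hr => by rw [mul_assoc]; exact ha.2 _ (hb.2 _ hr)⟩
      one_mem' := ⟨one_ne_zero, fun r hr => by rwa [one_mul]⟩ }
  have hSH : Submonoid.closure S ≤ H :=
    Submonoid.closure_le.2 fun s hs => ⟨fun h => hS (h ▸ hs), h2 s hs⟩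
  have hHJ : ∀ h ∈ H, h ∈ J := by
    rintro h ⟨hne, hh⟩ r hr
    have h3 : h⁻¹ * r ∈ R :=
      mem_of_injective_mapsTo R (h * ·) (mul_right_injective₀ hne) hh
        (by simpa [mul_inv_cancel_left₀ hne] using hr)
    have h4 := hh _ (h1' _ h3)
    have : h * (h⁻¹ * r + 1) = r + h := by field_simp
    rwa [this] at h4
  intro x hx
  have hx' := Subring.mem_closure_iff.1 hx
  have hJ : AddSubgroup.closure (Submonoid.closure S : Set F) ≤ J :=
    (AddSubgroup.closure_le J).2 fun s hs => hHJ s (hSH hs)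
  have := hJ hx' 0 h0
  rwa [zero_add] at this

theorem exists_subfield_coe_eq [Fintype F] (A : Subring F) :
    ∃ G : Subfield F, (G : Set F) = (A : Set F) := by
  refine ⟨{ A with inv_mem' := fun x hx => ?_ }, rfl⟩
  by_cases h0 : x = 0
  · rw [h0, inv_zero]; exact A.zero_mem
  · have hq : 2 ≤ Fintype.card F := Fintype.one_lt_card
    have : x⁻¹ = x ^ (Fintype.card F - 2) := by
      apply inv_eq_of_mul_eq_one_right
      rw [← pow_succ', show Fintype.card F - 2 + 1 = Fintype.card F - 1 by omega]
      exact FiniteField.pow_card_sub_one_eq_one x h0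
    rw [this]
    exact A.pow_mem hx _

end Closure

section Dichotomy

variable {F : Type*} [Field F] [DecidableEq F]

theorem pivot_numerics {τ c u v s₁ s₂ M Q z P m : ℕ} (h1 : c ≤ 2 * u) (h2 : τ ≤ z)
    (h3 : 3 * z ≤ 4 * v) (h4 : s₁ * τ ^ 2 ≤ 16 * M ^ 2) (h5 : s₂ * τ ≤ 4 * M)
    (h6 : v * u ^ 2 ≤ 4 * m * P) (h7 : P ≤ s₁ * s₂ * Q) (h8 : m ≤ M) :
    τ ^ 4 * c ^ 2 ≤ 4096 * M ^ 4 * Q := by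
  have a1 : 3 * τ ≤ 4 * v := by omega
  have a2 : 3 * (τ ^ 4 * c ^ 2) ≤ 4096 * M ^ 4 * Q := by
    calc 3 * (τ ^ 4 * c ^ 2) = τ ^ 3 * ((3 * τ) * c ^ 2) := by ring
      _ ≤ τ ^ 3 * ((4 * v) * (2 * u) ^ 2) := by gcongr
      _ = 16 * τ ^ 3 * (v * u ^ 2) := by ring
      _ ≤ 16 * τ ^ 3 * (4 * m * P) := by gcongr
      _ ≤ 16 * τ ^ 3 * (4 * M * (s₁ * s₂ * Q)) := by gcongr
      _ = 64 * M * Q * (s₁ * τ ^ 2) * (s₂ * τ) := by ring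
      _ ≤ 64 * M * Q * (16 * M ^ 2) * (4 * M) := by gcongr
      _ = _ := by ring
  omega

theorem mul_numerics {τ u w s₁ s₂ M Q z w' P : ℕ} (h1 : τ ≤ z) (h2 : 3 * z ≤ 4 * u)
    (h3 : τ ≤ w') (h4 : w' ≤ 2 * w) (h5 : s₁ * τ ≤ 4 * M) (h6 : s₂ * τ ^ 2 ≤ 16 * M ^ 2)
    (h7 : u * w ≤ P) (h8 : P ≤ s₁ * s₂ * Q) : τ ^ 5 ≤ 512 * M ^ 3 * Q := by
  have a1 : 3 * τ ≤ 4 * u := by omega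
  have a2 : 3 * τ ^ 5 ≤ 512 * M ^ 3 * Q := by
    calc 3 * τ ^ 5 = τ ^ 3 * ((3 * τ) * τ) := by ring
      _ ≤ τ ^ 3 * ((4 * u) * (2 * w)) := by gcongr; omega
      _ = 8 * τ ^ 3 * (u * w) := by ring
      _ ≤ 8 * τ ^ 3 * (s₁ * s₂ * Q) := Nat.mul_le_mul_left _ (h7.trans h8)
      _ = 8 * Q * (s₁ * τ) * (s₂ * τ ^ 2) := by ring
      _ ≤ 8 * Q * (4 * M) * (16 * M ^ 2) := by gcongr
      _ = _ := by ring
  omega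

theorem field_numerics {τ c u v s₁ s₂ M Q P s : ℕ} (hc : 0 < c) (h1 : c ≤ 2 * u) (h2 : c ≤ 2 * v)
    (h3 : s₁ * τ ^ 2 ≤ 16 * M ^ 2) (h4 : s₂ * τ ^ 2 ≤ 16 * M ^ 2)
    (h5 : (u * v) ^ 2 * s ≤ P * (s * c ^ 2 + c ^ 4)) (h6 : P ≤ s₁ * s₂ * Q) :
    τ ^ 4 * c ^ 2 * s ≤ 4096 * M ^ 4 * Q * (s + c ^ 2) := by
  refine Nat.le_of_mul_le_mul_right ?_ (show 0 < c ^ 2 by positivity)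
  calc τ ^ 4 * c ^ 2 * s * c ^ 2 = τ ^ 4 * s * (c * c) ^ 2 := by ring
    _ ≤ τ ^ 4 * s * ((2 * u) * (2 * v)) ^ 2 := by gcongr
    _ = 16 * τ ^ 4 * ((u * v) ^ 2 * s) := by ring
    _ ≤ 16 * τ ^ 4 * (s₁ * s₂ * Q * (s * c ^ 2 + c ^ 4)) := by
        exact Nat.mul_le_mul_left _ (h5.trans (Nat.mul_le_mul_right _ h6))
    _ = 16 * Q * (s * c ^ 2 + c ^ 4) * (s₁ * τ ^ 2) * (s₂ * τ ^ 2) := by ring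
    _ ≤ 16 * Q * (s * c ^ 2 + c ^ 4) * (16 * M ^ 2) * (16 * M ^ 2) := by gcongr
    _ = _ := by ring

theorem card_bound_of_sub_one_notMem (B C : Finset F) (x₀ : F) (hx₀ : x₀ ≠ 0) (hCB : C ⊆ B)
    (τ : ℕ) (hτ0 : 0 < τ) (hτ : ∀ c ∈ C, τ ≤ (C.filter fun v => c / x₀ * v ∈ B).card)
    (r : F) (hr : r ∈ quotientSet C) (hr1 : r - 1 ∉ quotientSet C) :
    τ ^ 4 * C.card ^ 2 ≤ 4096 * (B - B).card ^ 4 * (2 • B - 2 • B).card := by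
  obtain ⟨a, ha, b, hb, c, hc, d, hd, hcd, rfl⟩ := hr
  have hZB : ∀ e, (C.filter fun v => e / x₀ * v ∈ B) ⊆ B := fun e =>
    (Finset.filter_subset _ _).trans hCB
  have hZ : ∀ e, ∀ z ∈ (C.filter fun v => e / x₀ * v ∈ B), e / x₀ * z ∈ B := fun e z hz =>
    (Finset.mem_filter.1 hz).2
  obtain ⟨S₁, U, hUC, hU, hS₁, hU'⟩ := exists_cover_sub B C _ _ (c / x₀) (d / x₀) τ hτ0 hCB
    (hZB c) (hZ c) (hτ c hc) (hZB d) (hZ d) (hτ d hd)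
  obtain ⟨S₂, V, hVZ, hV, hS₂, hV'⟩ := exists_cover_sub_of_mul_mem B _ _ (a / x₀) (b / x₀) τ hτ0
    (hZB a) (hZ a) (hZB b) (hZ b) (hτ b hb)
  have hp : c / x₀ - d / x₀ ≠ 0 := by
    rw [← sub_div]; exact div_ne_zero (sub_ne_zero.2 hcd) hx₀
  have hq : (a / x₀ - b / x₀) / (c / x₀ - d / x₀) = (a - b) / (c - d) := by
    rw [← sub_div, ← sub_div, div_div_div_cancel_right₀ hx₀]
  have h1 := card_add_dilate_le B U V S₁ S₂ _ _ hp hU' hV'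
  rw [hq] at h1
  have hVC : V ⊆ C := hVZ.trans (Finset.filter_subset _ _)
  have hCpos : 0 < C.card := Finset.card_pos.2 ⟨a, ha⟩
  have hτa := hτ a ha
  have hUne : U.Nonempty := Finset.card_pos.1 (by omega)
  have hVne : V.Nonempty := Finset.card_pos.1 (by omega)
  exact pivot_numerics hU hτa hV hS₁ hS₂ (pivot_lower_bound C U V hUC hVC hUne hVne _ hr1) h1
    (Finset.card_le_card (Finset.sub_subset_sub hCB hCB))

theorem card_bound_of_mul_notMem (B C : Finset F) (x₀ : F) (hx₀ : x₀ ≠ 0) (hCB : C ⊆ B)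
    (h0 : (0 : F) ∉ B)
    (τ : ℕ) (hτ0 : 0 < τ) (hτ : ∀ c ∈ C, τ ≤ (C.filter fun v => c / x₀ * v ∈ B).card)
    (r e : F) (hr : r ∈ quotientSet C) (he : e ∈ C) (hr1 : e / x₀ * r ∉ quotientSet C) :
    τ ^ 5 ≤ 512 * (B - B).card ^ 3 * (2 • B - 2 • B).card := by
  obtain ⟨a, ha, b, hb, c, hc, d, hd, hcd, rfl⟩ := hr
  have hZB : ∀ e, (C.filter fun v => e / x₀ * v ∈ B) ⊆ B := fun e =>
    (Finset.filter_subset _ _).trans hCB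
  have hZ : ∀ e, ∀ z ∈ (C.filter fun v => e / x₀ * v ∈ B), e / x₀ * z ∈ B := fun e z hz =>
    (Finset.mem_filter.1 hz).2
  have he0 : e / x₀ ≠ 0 := div_ne_zero (fun h => h0 (h ▸ hCB he)) hx₀
  set Z := C.filter fun v => e / x₀ * v ∈ B with hZdef
  set W := Z.image (e / x₀ * ·) with hW
  have hWB : W ⊆ B := by
    intro w hw
    obtain ⟨z, hz, rfl⟩ := Finset.mem_image.1 hw
    exact hZ e z hz
  have hWc : W.card = Z.card := Finset.card_image_of_injective _ (mul_right_injective₀ he0)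
  obtain ⟨S₁, U, hUZ, hU, hS₁, hU'⟩ := exists_cover_sub_of_mul_mem B _ _ (c / x₀) (d / x₀) τ hτ0
    (hZB c) (hZ c) (hZB d) (hZ d) (hτ d hd)
  obtain ⟨S₂, W₀, hW₀, hWW, hS₂, hW'⟩ := exists_cover_sub B W _ _ (a / x₀) (b / x₀) τ hτ0 hWB
    (hZB a) (hZ a) (hτ a ha) (hZB b) (hZ b) (hτ b hb)
  have hp : c / x₀ - d / x₀ ≠ 0 := by
    rw [← sub_div]; exact div_ne_zero (sub_ne_zero.2 hcd) hx₀
  have hq : (a / x₀ - b / x₀) / (c / x₀ - d / x₀) = (a - b) / (c - d) := by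
    rw [← sub_div, ← sub_div, div_div_div_cancel_right₀ hx₀]
  have h1 := card_add_dilate_le B U W₀ S₁ S₂ _ _ hp hU' hW'
  rw [hq] at h1
  set V := Z.filter fun v => e / x₀ * v ∈ W₀ with hV
  have hVC : V ⊆ C := (Finset.filter_subset _ _).trans (Finset.filter_subset _ _)
  have hWV : W₀.card ≤ V.card := by
    have : W₀ ⊆ V.image (e / x₀ * ·) := by
      intro w hw
      obtain ⟨z, hz, rfl⟩ := Finset.mem_image.1 (hW₀ hw)
      exact Finset.mem_image_of_mem _ (Finset.mem_filter.2 ⟨hz, hw⟩)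
    exact (Finset.card_le_card this).trans Finset.card_image_le
  have h2 := card_mul_card_le_of_notMem_quotientSet C U V
    (hUZ.trans (Finset.filter_subset _ _)) hVC _ hr1
  have h3 : U + V.image (e / x₀ * ((a - b) / (c - d)) * ·) ⊆
      U + W₀.image ((a - b) / (c - d) * ·) := by
    refine Finset.add_subset_add_left fun y hy => ?_
    obtain ⟨v, hv, rfl⟩ := Finset.mem_image.1 hy
    refine Finset.mem_image.2 ⟨e / x₀ * v, (Finset.mem_filter.1 hv).2, ?_⟩
    show (a - b) / (c - d) * (e / x₀ * v) = e / x₀ * ((a - b) / (c - d)) * v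
    ring
  have h4 : U.card * W₀.card ≤ (U + W₀.image ((a - b) / (c - d) * ·)).card :=
    (Nat.mul_le_mul_left _ hWV).trans (h2.trans (Finset.card_le_card h3))
  exact mul_numerics (hτ c hc) hU (by rw [hWc]; exact hτ e he) hWW hS₁ hS₂ h4 h1

theorem card_bound_of_subfield [Fintype F] (B C : Finset F) (x₀ : F) (hx₀ : x₀ ≠ 0) (hCB : C ⊆ B)
    (hC : C.Nonempty)
    (τ : ℕ) (hτ0 : 0 < τ) (hτ : ∀ c ∈ C, τ ≤ (C.filter fun v => c / x₀ * v ∈ B).card)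
    (G : Subfield F) (hG : (G : Set F) ⊆ quotientSet C) :
    ((τ : ℝ) ^ 4 * (C.card : ℝ) ^ 2 ≤ 4096 * ((B - B).card : ℝ) ^ 4 * (2 • B - 2 • B).card *
      (1 + 2 * (C.card : ℝ) ^ 2 / Nat.card G)) := by
  classical
  have hZB : ∀ e, (C.filter fun v => e / x₀ * v ∈ B) ⊆ B := fun e =>
    (Finset.filter_subset _ _).trans hCB
  have hZ : ∀ e, ∀ z ∈ (C.filter fun v => e / x₀ * v ∈ B), e / x₀ * z ∈ B := fun e z hz =>
    (Finset.mem_filter.1 hz).2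
  set T : Finset F := Finset.univ.filter fun x => x ∈ G with hT
  have hTc : T.card = Nat.card G := by
    rw [Nat.card_eq_fintype_card, Fintype.card_subtype]
  set S := T.erase 0 with hS
  have h0T : (0 : F) ∈ T := by simp [hT, G.zero_mem]
  have h1T : (1 : F) ∈ T := by simp [hT, G.one_mem]
  have hSc : S.card + 1 = T.card := Finset.card_erase_add_one h0T
  have h1S : (1 : F) ∈ S := Finset.mem_erase.2 ⟨one_ne_zero, h1T⟩
  have hSpos : 0 < S.card := Finset.card_pos.2 ⟨1, h1S⟩
  obtain ⟨ξ, hξ, hgood⟩ := exists_good_dilate C S ⟨1, h1S⟩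
  have hξG : ξ ∈ (G : Set F) := (Finset.mem_filter.1 (Finset.mem_erase.1 hξ).2).2
  obtain ⟨a, ha, b, hb, c, hc, d, hd, hcd, rfl⟩ := hG hξG
  obtain ⟨S₁, U, hUC, hU, hS₁, hU'⟩ := exists_cover_sub B C _ _ (c / x₀) (d / x₀) τ hτ0 hCB
    (hZB c) (hZ c) (hτ c hc) (hZB d) (hZ d) (hτ d hd)
  obtain ⟨S₂, V, hVC, hV, hS₂, hV'⟩ := exists_cover_sub B C _ _ (a / x₀) (b / x₀) τ hτ0 hCB
    (hZB a) (hZ a) (hτ a ha) (hZB b) (hZ b) (hτ b hb)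
  have hp : c / x₀ - d / x₀ ≠ 0 := by
    rw [← sub_div]; exact div_ne_zero (sub_ne_zero.2 hcd) hx₀
  have hq : (a / x₀ - b / x₀) / (c / x₀ - d / x₀) = (a - b) / (c - d) := by
    rw [← sub_div, ← sub_div, div_div_div_cancel_right₀ hx₀]
  have h1 := card_add_dilate_le B U V S₁ S₂ _ _ hp hU' hV'
  rw [hq] at h1
  have h2 := field_numerics hC.card_pos hU hV hS₁ hS₂ (hgood U hUC V hVC) h1
  have h3 : ((τ : ℝ) ^ 4 * (C.card : ℝ) ^ 2) * S.card ≤ 4096 * ((B - B).card : ℝ) ^ 4 *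
      (2 • B - 2 • B).card * (S.card + (C.card : ℝ) ^ 2) := by exact_mod_cast h2
  have hS0 : (0 : ℝ) < S.card := Nat.cast_pos.2 hSpos
  have h4 : (τ : ℝ) ^ 4 * (C.card : ℝ) ^ 2 ≤ 4096 * ((B - B).card : ℝ) ^ 4 *
      (2 • B - 2 • B).card * (1 + (C.card : ℝ) ^ 2 / S.card) := by
    refine le_of_mul_le_mul_right (h3.trans (le_of_eq ?_)) hS0
    field_simp
  refine h4.trans (mul_le_mul_of_nonneg_left ?_ (by positivity))
  have h5 : (Nat.card G : ℝ) ≤ 2 * S.card := by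
    rw [← hTc]; exact_mod_cast (show T.card ≤ 2 * S.card by omega)
  have hG0 : (0 : ℝ) < Nat.card G := by rw [← hTc, ← hSc]; positivity
  have : (C.card : ℝ) ^ 2 / S.card ≤ 2 * (C.card : ℝ) ^ 2 / Nat.card G := by
    rw [div_le_div_iff₀ hS0 hG0]
    calc (C.card : ℝ) ^ 2 * Nat.card G ≤ (C.card : ℝ) ^ 2 * (2 * S.card) :=
          mul_le_mul_of_nonneg_left h5 (by positivity)
      _ = _ := by ring
  linarith

theorem SubfieldAntiConcentrated.mono {F : Type*} [Field F] [Finite F] {C : ℝ} {X Y : Finset F}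
    (h : SubfieldAntiConcentrated C X) (hYX : Y ⊆ X) : SubfieldAntiConcentrated C Y := by
  intro G hG c
  refine le_trans ?_ (h G hG c)
  exact_mod_cast Set.ncard_le_ncard
    (Set.inter_subset_inter_left _ (Finset.coe_subset.2 hYX)) (Set.toFinite _)

/-- The alternative behind the sum-product estimate: `C` is a subset of `B` such that every `c ∈ C`
has at least `τ` multiples `c v / x₀ ∈ B` with `v ∈ C`. -/
theorem card_bound_dichotomy [Fintype F] (B C : Finset F) (x₀ : F) (hx₀ : x₀ ≠ 0) (hCB : C ⊆ B)
    (hB0 : (0 : F) ∉ B) (hC : C.Nonempty)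
    (τ : ℕ) (hτ0 : 0 < τ) (hτ : ∀ c ∈ C, τ ≤ (C.filter fun v => c / x₀ * v ∈ B).card)
    (A : ℝ) (hanti : SubfieldAntiConcentrated A C) :
    ((τ : ℝ) ^ 4 * (C.card : ℝ) ^ 2 ≤ 4096 * ((B - B).card : ℝ) ^ 4 * (2 • B - 2 • B).card *
      ((1 + 2 * A ^ 2) * (1 + 2 * (C.card : ℝ) ^ 2 / Fintype.card F))) ∨
    (τ : ℝ) ^ 5 ≤ 512 * ((B - B).card : ℝ) ^ 3 * (2 • B - 2 • B).card := by
  have hone : (1 : ℝ) ≤ (1 + 2 * A ^ 2) * (1 + 2 * (C.card : ℝ) ^ 2 / Fintype.card F) := by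
    have h1 : (1 : ℝ) ≤ 1 + 2 * A ^ 2 := by nlinarith [sq_nonneg A]
    have h2 : (1 : ℝ) ≤ 1 + 2 * (C.card : ℝ) ^ 2 / Fintype.card F := by
      have : (0 : ℝ) ≤ 2 * (C.card : ℝ) ^ 2 / Fintype.card F := by positivity
      linarith
    exact one_le_mul_of_one_le_of_one_le h1 h2
  have hweak : τ ^ 4 * C.card ^ 2 ≤ 4096 * (B - B).card ^ 4 * (2 • B - 2 • B).card →
      (τ : ℝ) ^ 4 * (C.card : ℝ) ^ 2 ≤ 4096 * ((B - B).card : ℝ) ^ 4 * (2 • B - 2 • B).card *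
      ((1 + 2 * A ^ 2) * (1 + 2 * (C.card : ℝ) ^ 2 / Fintype.card F)) := by
    intro h
    have h' : (τ : ℝ) ^ 4 * (C.card : ℝ) ^ 2 ≤
        4096 * ((B - B).card : ℝ) ^ 4 * (2 • B - 2 • B).card := by exact_mod_cast h
    exact h'.trans (le_mul_of_one_le_right (by positivity) hone)
  obtain ⟨c₀, hc₀⟩ := hC
  have hBne : B.Nonempty := ⟨c₀, hCB hc₀⟩
  rcases Nat.lt_or_ge 1 C.card with hC1 | hC1
  swap
  · left; apply hweak
    have h1 : τ ≤ 1 := (hτ c₀ hc₀).trans ((Finset.card_filter_le _ _).trans hC1)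
    have h2 : 0 < (B - B).card := (hBne.sub hBne).card_pos
    have h3 : 0 < (2 • B - 2 • B).card := by
      rw [two_nsmul]; exact ((hBne.add hBne).sub (hBne.add hBne)).card_pos
    calc τ ^ 4 * C.card ^ 2 ≤ 1 ^ 4 * 1 ^ 2 := by gcongr
      _ ≤ 4096 * (B - B).card ^ 4 * (2 • B - 2 • B).card := by
        have := Nat.mul_pos (pow_pos h2 4) h3
        nlinarith
  by_cases hp : ∀ r ∈ quotientSet C, r - 1 ∈ quotientSet C
  swap
  · push Not at hp
    obtain ⟨r, hr, hr1⟩ := hp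
    exact Or.inl (hweak (card_bound_of_sub_one_notMem B C x₀ hx₀ hCB τ hτ0 hτ r hr hr1))
  by_cases hm : ∀ e ∈ C, ∀ r ∈ quotientSet C, e / x₀ * r ∈ quotientSet C
  swap
  · push Not at hm
    obtain ⟨e, he, r, hr, hr1⟩ := hm
    right
    exact_mod_cast card_bound_of_mul_notMem B C x₀ hx₀ hCB hB0 τ hτ0 hτ r e hr he hr1
  left
  obtain ⟨u, hu, v, hv, huv⟩ := Finset.one_lt_card.1 hC1
  have h0R : (0 : F) ∈ quotientSet C := ⟨u, hu, u, hu, u, hu, v, hv, huv, by simp⟩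
  have hsub := subring_closure_subset (quotientSet C) ((fun e => e / x₀) '' (C : Set F)) h0R
    (by
      rintro ⟨e, he, h⟩
      exact div_ne_zero (fun h0 => hB0 (h0 ▸ hCB (Finset.mem_coe.1 he))) hx₀ h) hp
    (by
      rintro _ ⟨e, he, rfl⟩ r hr
      exact hm e he r hr)
  obtain ⟨G, hG⟩ := exists_subfield_coe_eq (Subring.closure ((fun e => e / x₀) '' (C : Set F)))
  have hCG : ∀ c ∈ C, c ∈ x₀ • (G : Set F) := by
    intro c hc
    refine ⟨c / x₀, ?_, by simp [mul_div_cancel₀, hx₀]⟩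
    rw [hG]
    exact Subring.subset_closure ⟨c, hc, rfl⟩
  refine (card_bound_of_subfield B C x₀ hx₀ hCB ⟨c₀, hc₀⟩ τ hτ0 hτ G (hG ▸ hsub)).trans
    (mul_le_mul_of_nonneg_left ?_ (by positivity))
  have hq0 : (0 : ℝ) ≤ 2 * (C.card : ℝ) ^ 2 / Fintype.card F := by positivity
  by_cases htop : G = ⊤
  · have : Nat.card G = Fintype.card F := by
      subst htop
      rw [← Nat.card_eq_fintype_card]
      exact Nat.card_congr (Equiv.Set.univ F)
    rw [this]
    nlinarith [sq_nonneg A]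
  · have h1 := hanti G htop x₀
    have h2 : ((C : Set F) ∩ x₀ • (G : Set F)) = C :=
      Set.inter_eq_left.2 fun c hc => hCG c (Finset.mem_coe.1 hc)
    rw [h2, Set.ncard_coe_finset] at h1
    have hG0 : (0 : ℝ) < Nat.card G := Nat.cast_pos.2 Nat.card_pos
    have h3 : (C.card : ℝ) ^ 2 ≤ A ^ 2 * Nat.card G := by
      calc (C.card : ℝ) ^ 2 ≤ (A * (Nat.card G : ℝ) ^ (1 / 2 : ℝ)) ^ 2 := by gcongr
        _ = A ^ 2 * Nat.card G := by
          rw [mul_pow, ← Real.sqrt_eq_rpow, Real.sq_sqrt hG0.le]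
    have h4 : 2 * (C.card : ℝ) ^ 2 / Nat.card G ≤ 2 * A ^ 2 := by
      rw [div_le_iff₀ hG0]; linarith
    nlinarith [sq_nonneg A, mul_nonneg (sq_nonneg A) hq0]

end Dichotomy

theorem energy_numerics_main {E Λ s τ n N L K M Q c q : ℝ} (hE0 : 0 ≤ E) (hΛ : 0 < Λ) (hs : 0 < s)
    (hsn : s ≤ n) (hnN : n ≤ N) (hL : 0 < L) (hK : 0 < K) (hM0 : 0 ≤ M)
    (hQ0 : 0 ≤ Q)
    (hc : 1 ≤ c) (hq : 0 < q) (hE : E ≤ 4 * Λ * s * τ * n)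
    (hM : M * N ^ 2 ≤ 2 ^ 36 * Λ ^ 4 * K ^ 4 * n ^ 3) (hQ : Q ≤ 2 ^ 87 * Λ ^ 12 * K ^ 12 * n)
    (h : τ ^ 4 * s ^ 2 ≤ 4096 * M ^ 4 * Q * (c * (1 + 2 * s ^ 2 / q)))
    (h1 : K ^ 28 * L ^ 4 ≤ N) (h2 : K ^ 28 * L ^ 4 * N ≤ q) :
    E * N * L ≤ 2 ^ 64 * c * Λ ^ 8 * n ^ 4 := by
  have hn : 0 < n := hs.trans_le hsn
  have hN : 0 < N := hn.trans_le hnN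
  have hc0 : 0 < c := by linarith
  have hw : 0 ≤ 1 + 2 * s ^ 2 / q := by positivity
  have hKL : K ^ 28 * L ^ 4 * s ^ 2 * (1 + 2 * s ^ 2 / q) ≤ 3 * n ^ 2 * N := by
    have a1 : K ^ 28 * L ^ 4 * s ^ 2 ≤ N * n ^ 2 := by gcongr
    have a2 : K ^ 28 * L ^ 4 * s ^ 2 * (2 * s ^ 2 / q) ≤ 2 * n ^ 2 * N := by
      rw [mul_div_assoc', div_le_iff₀ hq]
      calc K ^ 28 * L ^ 4 * s ^ 2 * (2 * s ^ 2) ≤ K ^ 28 * L ^ 4 * N ^ 2 * (2 * n ^ 2) := by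
            gcongr; exact hsn.trans hnN
        _ = 2 * n ^ 2 * N * (K ^ 28 * L ^ 4 * N) := by ring
        _ ≤ 2 * n ^ 2 * N * q := by gcongr
    linarith
  have key : (E * N * L) ^ 4 * N ^ 4 ≤ (2 ^ 64 * c * Λ ^ 8 * n ^ 4) ^ 4 * N ^ 4 := by
    calc (E * N * L) ^ 4 * N ^ 4 ≤ ((4 * Λ * s * τ * n) * N * L) ^ 4 * N ^ 4 := by gcongr
      _ = 256 * Λ ^ 4 * n ^ 4 * L ^ 4 * s ^ 2 * N ^ 8 * (τ ^ 4 * s ^ 2) := by ring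
      _ ≤ 256 * Λ ^ 4 * n ^ 4 * L ^ 4 * s ^ 2 * N ^ 8 *
          (4096 * M ^ 4 * Q * (c * (1 + 2 * s ^ 2 / q))) := by gcongr
      _ = 256 * 4096 * Λ ^ 4 * n ^ 4 * L ^ 4 * s ^ 2 * (c * (1 + 2 * s ^ 2 / q)) *
          ((M * N ^ 2) ^ 4 * Q) := by ring
      _ ≤ 256 * 4096 * Λ ^ 4 * n ^ 4 * L ^ 4 * s ^ 2 * (c * (1 + 2 * s ^ 2 / q)) *
          ((2 ^ 36 * Λ ^ 4 * K ^ 4 * n ^ 3) ^ 4 * (2 ^ 87 * Λ ^ 12 * K ^ 12 * n)) := by gcongr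
      _ = 2 ^ 251 * (c * (Λ ^ 32 * (n ^ 17 *
          (K ^ 28 * L ^ 4 * s ^ 2 * (1 + 2 * s ^ 2 / q))))) := by ring
      _ ≤ 2 ^ 251 * (c * (Λ ^ 32 * (n ^ 17 * (3 * n ^ 2 * N)))) := by gcongr
      _ = (2 ^ 251 * 3) * (c * (Λ ^ 32 * (n ^ 16 * (n ^ 3 * N)))) := by ring
      _ ≤ 2 ^ 256 * (c ^ 4 * (Λ ^ 32 * (n ^ 16 * (N ^ 3 * N)))) := by
        gcongr
        · norm_num
        · exact le_self_pow₀ hc (by norm_num)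
      _ = _ := by ring
  have key' := le_of_mul_le_mul_right key (by positivity)
  exact (pow_le_pow_iff_left₀ (by positivity) (by positivity) (by norm_num)).1 key'

theorem energy_numerics_secondary {E Λ s τ n N L K M Q c : ℝ} (hE0 : 0 ≤ E) (hΛ : 1 ≤ Λ)
    (hs : 0 < s) (hsn : s ≤ n) (hnN : n ≤ N) (hL : 0 < L) (hK : 0 < K) (hM0 : 0 ≤ M)
    (hQ0 : 0 ≤ Q)
    (hc : 1 ≤ c) (hE : E ≤ 4 * Λ * s * τ * n)
    (hM : M * N ^ 2 ≤ 2 ^ 36 * Λ ^ 4 * K ^ 4 * n ^ 3) (hQ : Q ≤ 2 ^ 87 * Λ ^ 12 * K ^ 12 * n)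
    (h : τ ^ 5 ≤ 512 * M ^ 3 * Q) (h1 : K ^ 24 * L ^ 5 ≤ N) :
    E * N * L ≤ 2 ^ 64 * c * Λ ^ 8 * n ^ 4 := by
  have hn : 0 < n := hs.trans_le hsn
  have hN : 0 < N := hn.trans_le hnN
  have hΛ0 : 0 < Λ := by linarith
  have key : (E * N * L) ^ 5 * N ≤ (2 ^ 50 * c * Λ ^ 8 * n ^ 4) ^ 5 * N := by
    calc (E * N * L) ^ 5 * N ≤ ((4 * Λ * s * τ * n) * N * L) ^ 5 * N := by gcongr
      _ = 1024 * Λ ^ 5 * n ^ 5 * L ^ 5 * s ^ 5 * N ^ 6 * τ ^ 5 := by ring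
      _ ≤ 1024 * Λ ^ 5 * n ^ 5 * L ^ 5 * s ^ 5 * N ^ 6 * (512 * M ^ 3 * Q) := by gcongr
      _ = 1024 * 512 * Λ ^ 5 * n ^ 5 * L ^ 5 * s ^ 5 * ((M * N ^ 2) ^ 3 * Q) := by ring
      _ ≤ 1024 * 512 * Λ ^ 5 * n ^ 5 * L ^ 5 * n ^ 5 *
          ((2 ^ 36 * Λ ^ 4 * K ^ 4 * n ^ 3) ^ 3 * (2 ^ 87 * Λ ^ 12 * K ^ 12 * n)) := by gcongr
      _ = 2 ^ 214 * (1 * (Λ ^ 29 * (n ^ 20 * (K ^ 24 * L ^ 5)))) := by ring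
      _ ≤ 2 ^ 250 * (c ^ 5 * (Λ ^ 40 * (n ^ 20 * N))) := by
        gcongr
        · norm_num
        · norm_num
        · exact one_le_pow₀ hc
        · norm_num
      _ = _ := by ring
  have key' := le_of_mul_le_mul_right key hN
  have key'' := (pow_le_pow_iff_left₀ (by positivity) (by positivity) (by norm_num)).1 key'
  refine key''.trans ?_
  gcongr
  · norm_num
  · norm_num

/-- A set with small doubling that is not concentrated on dilates of subfields has small
multiplicative energy. -/
theorem mulCollisions_le_of_small_doubling {F : Type*} [Field F] [Fintype F] [DecidableEq F]
    (B : Finset F) (hB0 : (0 : F) ∉ B) (hne : B.Nonempty) (A : ℝ)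
    (hanti : SubfieldAntiConcentrated A B) (N K L Λ : ℝ) (hBN : (B.card : ℝ) ≤ N)
    (hK : 0 < K) (hL : 0 < L) (hΛ : 1 ≤ Λ)
    (hH : ∑ i ∈ Finset.range B.card, (1 : ℝ) / (i + 1) ≤ Λ)
    (hM : ((B - B).card : ℝ) * N ^ 2 ≤ 2 ^ 36 * Λ ^ 4 * K ^ 4 * (B.card : ℝ) ^ 3)
    (hQ : ((2 • B - 2 • B).card : ℝ) ≤ 2 ^ 87 * Λ ^ 12 * K ^ 12 * B.card)
    (h1 : K ^ 28 * L ^ 4 ≤ N) (h2 : K ^ 28 * L ^ 4 * N ≤ Fintype.card F)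
    (h3 : K ^ 24 * L ^ 5 ≤ N) :
    (collisions (B ×ˢ B) (fun t : F × F => t.1 * t.2) : ℝ) * N * L ≤
      2 ^ 64 * (1 + 2 * A ^ 2) * Λ ^ 8 * (B.card : ℝ) ^ 4 := by
  have hΛ0 : 0 < Λ := by linarith
  obtain ⟨x₀, hx₀B, hx₀⟩ := exists_many_pairs_mul B hB0 hne
  have hx₀0 : x₀ ≠ 0 := fun h => hB0 (h ▸ hx₀B)
  have hEpos : 0 < collisions (B ×ˢ B) (fun t : F × F => t.1 * t.2) := by
    obtain ⟨b, hb⟩ := hne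
    exact Finset.card_pos.2 ⟨((b, b), (b, b)), by simp [hb]⟩
  have hP : 0 < ((B ×ˢ B).filter fun t => t.1 * t.2 / x₀ ∈ B).card :=
    Nat.pos_of_mul_pos_left (hEpos.trans_le hx₀)
  obtain ⟨C, hCB, hC, hdeg⟩ := exists_subset_min_degree B (fun c v => c * v / x₀ ∈ B)
    (fun a b h => by rwa [mul_comm]) Λ hH hΛ0 hP
  obtain ⟨P, hPdef⟩ : ∃ P : ℝ, P = (((B ×ˢ B).filter fun t => t.1 * t.2 / x₀ ∈ B).card : ℝ) :=
    ⟨_, rfl⟩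
  have hP0 : 0 < P := by rw [hPdef]; exact Nat.cast_pos.2 hP
  have hs : (0 : ℝ) < C.card := Nat.cast_pos.2 hC.card_pos
  have hfac : 0 < 4 * Λ * C.card := by positivity
  set τ := ⌈P / (4 * Λ * C.card)⌉₊ with hτdef
  have hτ0 : 0 < τ := Nat.ceil_pos.2 (by positivity)
  have hτ : ∀ c ∈ C, τ ≤ (C.filter fun v => c / x₀ * v ∈ B).card := by
    intro c hc
    have := hdeg c hc
    rw [← hPdef] at this
    have e1 : (C.filter fun v => c / x₀ * v ∈ B) = C.filter fun v => c * v / x₀ ∈ B := by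
      simp only [div_mul_eq_mul_div]
    rw [e1]
    refine Nat.ceil_le.2 ((div_le_iff₀ hfac).2 ?_)
    linarith
  have hτP : P ≤ 4 * Λ * C.card * τ := by
    have := (div_le_iff₀ hfac).1 (Nat.le_ceil (P / (4 * Λ * C.card)))
    linarith
  have hE : (collisions (B ×ˢ B) (fun t : F × F => t.1 * t.2) : ℝ) ≤
      4 * Λ * C.card * τ * B.card := by
    calc (collisions (B ×ˢ B) (fun t : F × F => t.1 * t.2) : ℝ) ≤ B.card * P := by
          rw [hPdef]; exact_mod_cast hx₀
      _ ≤ B.card * (4 * Λ * C.card * τ) := mul_le_mul_of_nonneg_left hτP (Nat.cast_nonneg _)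
      _ = _ := by ring
  have hCn : (C.card : ℝ) ≤ B.card := Nat.cast_le.2 (Finset.card_le_card hCB)
  have hc : (1 : ℝ) ≤ 1 + 2 * A ^ 2 := by nlinarith [sq_nonneg A]
  rcases card_bound_dichotomy B C x₀ hx₀0 hCB hB0 hC τ hτ0 hτ A (hanti.mono hCB) with h | h
  · exact energy_numerics_main (Nat.cast_nonneg _) hΛ0 hs hCn hBN hL hK (Nat.cast_nonneg _)
      (Nat.cast_nonneg _) hc (Nat.cast_pos.2 Fintype.card_pos) hE hM hQ h h1 h2
  · exact energy_numerics_secondary (Nat.cast_nonneg _) hΛ hs hCn hBN hL hK (Nat.cast_nonneg _)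
      (Nat.cast_nonneg _) hc hE hM hQ h h3

theorem le_of_pow_four_le_add {N q K E S T : ℝ} (hK : 0 < K) (hN : 0 < N) (hq : 0 < q) (hS : 0 ≤ S)
    (hT : 0 ≤ T) (h : S ^ 4 ≤ N ^ 7 * q * E) (hE : K * E ≤ N ^ 3) (hTK : N ^ 10 * q ≤ K * T ^ 4) :
    S ≤ T := by
  have h1 : K * S ^ 4 ≤ K * T ^ 4 := by
    calc K * S ^ 4 ≤ K * (N ^ 7 * q * E) := by gcongr
      _ = N ^ 7 * q * (K * E) := by ring
      _ ≤ N ^ 7 * q * N ^ 3 := by gcongr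
      _ = N ^ 10 * q := by ring
      _ ≤ _ := hTK
  exact (pow_le_pow_iff_left₀ hS hT (by norm_num)).1 (le_of_mul_le_mul_left h1 hK)

theorem le_of_pow_four_le_mul {N q L S T z P E y c b : ℝ} (hL : 0 < L) (hN : 0 < N) (hq : 0 < q)
    (hS : 0 ≤ S) (hT : 0 ≤ T) (hb : 0 ≤ b) (hP0 : 0 ≤ P) (hE0 : 0 ≤ E) (hz0 : 0 ≤ z)
    (hS2 : S ^ 2 ≤ z * (q * P)) (hz : z ≤ N) (hP : P ^ 2 ≤ E * y) (hy : y ≤ N ^ 3)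
    (hE : E * N * L ≤ c * b ^ 4) (hTL : c * q ^ 2 * N ^ 8 ≤ L * T ^ 4) : N * S ≤ b * T := by
  have h1 : L * (N * S) ^ 4 ≤ L * (b * T) ^ 4 := by
    calc L * (N * S) ^ 4 = L * N ^ 4 * (S ^ 2) ^ 2 := by ring
      _ ≤ L * N ^ 4 * (z * (q * P)) ^ 2 := by gcongr
      _ ≤ L * N ^ 4 * (N * (q * P)) ^ 2 := by gcongr
      _ = L * N ^ 6 * q ^ 2 * P ^ 2 := by ring
      _ ≤ L * N ^ 6 * q ^ 2 * (E * y) := by gcongr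
      _ ≤ L * N ^ 6 * q ^ 2 * (E * N ^ 3) := by gcongr
      _ = N ^ 8 * q ^ 2 * (E * N * L) := by ring
      _ ≤ N ^ 8 * q ^ 2 * (c * b ^ 4) := by gcongr
      _ = b ^ 4 * (c * q ^ 2 * N ^ 8) := by ring
      _ ≤ b ^ 4 * (L * T ^ 4) := by gcongr
      _ = _ := by ring
  exact (pow_le_pow_iff_left₀ (by positivity) (by positivity) (by norm_num)).1
    (le_of_mul_le_mul_left h1 hL)

/-- The trilinear sum over a set without subfield concentration: successively split off subsets with
small doubling, until the additive energy of what is left is small. -/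
theorem trilinear_sum_le {F : Type*} [Field F] [Fintype F] [DecidableEq F]
    {ψ : AddChar F ℂ} (hψ : ψ.IsPrimitive) (X Y Z : Finset F) (hX : (0 : F) ∉ X) (hY : (0 : F) ∉ Y)
    {A N K L Λ T₁ T₂ : ℝ} (hanti : SubfieldAntiConcentrated A X) (hN : 0 < N)
    (hXN : (X.card : ℝ) ≤ N) (hYN : (Y.card : ℝ) ≤ N) (hZN : (Z.card : ℝ) ≤ N)
    (hK : 0 < K) (hL : 0 < L) (hΛ : 1 ≤ Λ)
    (hlog : ∀ n : ℕ, (n : ℝ) ≤ N → ((Nat.log 2 n + 1 : ℕ) : ℝ) ≤ Λ)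
    (hharm : ∀ n : ℕ, (n : ℝ) ≤ N → ∑ i ∈ Finset.range n, (1 : ℝ) / (i + 1) ≤ Λ)
    (h1 : K ^ 28 * L ^ 4 ≤ N) (h2 : K ^ 28 * L ^ 4 * N ≤ Fintype.card F)
    (h3 : K ^ 24 * L ^ 5 ≤ N) (hT₁0 : 0 ≤ T₁) (hT₂0 : 0 ≤ T₂)
    (hT₁ : N ^ 10 * Fintype.card F ≤ K * T₁ ^ 4)
    (hT₂ : 2 ^ 64 * (1 + 2 * A ^ 2) * Λ ^ 8 * (Fintype.card F : ℝ) ^ 2 * N ^ 8 ≤ L * T₂ ^ 4)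
    (α β γ : F → ℂ) (hα : ∀ x ∈ X, ‖α x‖ ≤ 1) (hβ : ∀ y ∈ Y, ‖β y‖ ≤ 1)
    (hγ : ∀ z ∈ Z, ‖γ z‖ ≤ 1) :
    ‖∑ x ∈ X, ∑ y ∈ Y, ∑ z ∈ Z, α x * β y * γ z * ψ (x * y * z)‖ ≤ T₁ + T₂ := by
  have hq : (0 : ℝ) < Fintype.card F := Nat.cast_pos.2 Fintype.card_pos
  obtain ⟨f, hf⟩ : ∃ f : F → ℂ, f = fun x => ∑ y ∈ Y, ∑ z ∈ Z, α x * β y * γ z * ψ (x * y * z) :=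
    ⟨_, rfl⟩
  have key : ∀ n : ℕ, ∀ U ⊆ X, U.card = n → N * ‖∑ x ∈ U, f x‖ ≤ N * T₁ + U.card * T₂ := by
    intro n
    induction n using Nat.strong_induction_on with
    | _ n ih =>
    intro U hUX hUn
    have hUN : (U.card : ℝ) ≤ N := (Nat.cast_le.2 (Finset.card_le_card hUX)).trans hXN
    rcases U.eq_empty_or_nonempty with rfl | hU
    · simpa using mul_nonneg hN.le hT₁0
    rcases le_or_gt (K * (collisions (U ×ˢ U) (fun t : F × F => t.1 - t.2) : ℝ)) (N ^ 3) with hE | hE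
    · have h4 := trilinear_sum_le_addEnergy hψ U Y Z hY hYN hZN α β γ
        (fun x hx => hα x (hUX hx)) hβ hγ
      have h5 : ‖∑ x ∈ U, f x‖ ≤ T₁ := by
        rw [hf]
        exact le_of_pow_four_le_add hK hN hq (norm_nonneg _) hT₁0 h4 hE hT₁
      have h6 : 0 ≤ U.card * T₂ := mul_nonneg (Nat.cast_nonneg _) hT₂0
      nlinarith [mul_le_mul_of_nonneg_left h5 hN.le]
    · obtain ⟨B, hBU, hB, hM, hQ⟩ := exists_subset_small_doubling U hU N K Λ hUN hK hE.le
        (hlog _ hUN)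
      have hBX := hBU.trans hUX
      have hBN : (B.card : ℝ) ≤ N := (Nat.cast_le.2 (Finset.card_le_card hBU)).trans hUN
      have h4 := mulCollisions_le_of_small_doubling B (fun h => hX (hBX h)) hB A (hanti.mono hBX)
        N K L Λ hBN hK hL hΛ (hharm _ hBN) hM hQ h1 h2 h3
      have h5 := trilinear_sum_le_mulCollisions hψ B Y Z α β γ (fun x hx => hα x (hBX hx)) hβ hγ
      have h6 : (collisions (B ×ˢ Y) (fun x : F × F => x.1 * x.2) : ℝ) ^ 2 ≤
          (collisions (B ×ˢ B) (fun x : F × F => x.1 * x.2) : ℝ) *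
          (collisions (Y ×ˢ Y) (fun x : F × F => x.1 * x.2) : ℝ) := by
        exact_mod_cast collisions_mul_sq_le B Y (fun h => hX (hBX h)) hY
      have h7 : (collisions (Y ×ˢ Y) (fun x : F × F => x.1 * x.2) : ℝ) ≤ N ^ 3 := by
        have : (collisions (Y ×ˢ Y) (fun x : F × F => x.1 * x.2) : ℝ) ≤ (Y.card : ℝ) ^ 3 := by
          exact_mod_cast collisions_mul_self_le Y hY
        exact this.trans (pow_le_pow_left₀ (Nat.cast_nonneg _) hYN 3)
      have h8 : N * ‖∑ x ∈ B, f x‖ ≤ B.card * T₂ := by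
        rw [hf]
        exact le_of_pow_four_le_mul hL hN hq (norm_nonneg _) hT₂0 (Nat.cast_nonneg _)
          (Nat.cast_nonneg _) (Nat.cast_nonneg _) (Nat.cast_nonneg _) h5 hZN h6 h7 h4 hT₂
      have hcard := Finset.card_sdiff_add_card_eq_card hBU
      have h9 := ih (U \ B).card (by have := hB.card_pos; omega) (U \ B)
        (Finset.sdiff_subset.trans hUX) rfl
      have h10 : ‖∑ x ∈ U, f x‖ ≤ ‖∑ x ∈ U \ B, f x‖ + ‖∑ x ∈ B, f x‖ := by
        rw [← Finset.sum_sdiff hBU]; exact norm_add_le _ _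
      have h11 : (U.card : ℝ) = (U \ B).card + B.card := by rw [← hcard]; push_cast; ring
      rw [h11]
      linarith [mul_le_mul_of_nonneg_left h10 hN.le]
  have h4 := key X.card X subset_rfl rfl
  have h5 : N * ‖∑ x ∈ X, f x‖ ≤ N * (T₁ + T₂) := by
    have := mul_le_mul_of_nonneg_right hXN hT₂0
    linarith
  rw [hf] at h5
  exact le_of_mul_le_mul_left h5 hN

theorem exists_energy_parameters {a b : ℝ} (hb : 0 ≤ b) {M : ℝ}
    (h₁ : Real.exp (36 / 128 * a + 311 / 128 * b) ≤ M)
    (h₂ : Real.exp (35 / 128 * a + 313 / 128 * b) ≤ M) :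
    Real.exp b ^ 3 ≤ M ∨ ∃ K L : ℝ, 0 < K ∧ 0 < L ∧ K ^ 28 * L ^ 4 ≤ Real.exp b ∧
      K ^ 28 * L ^ 4 * Real.exp b ≤ Real.exp a ∧ K ^ 24 * L ^ 5 ≤ Real.exp b ∧
      Real.exp b ^ 10 * Real.exp a ≤ K * M ^ 4 ∧ Real.exp a ^ 2 * Real.exp b ^ 8 ≤ L * M ^ 4 := by
  have key : ∀ k l m : ℝ, Real.exp m ≤ M → 28 * k + 4 * l ≤ b → 28 * k + 4 * l + b ≤ a →
      24 * k + 5 * l ≤ b → 10 * b + a ≤ k + 4 * m → 2 * a + 8 * b ≤ l + 4 * m →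
      ∃ K L : ℝ, 0 < K ∧ 0 < L ∧ K ^ 28 * L ^ 4 ≤ Real.exp b ∧
      K ^ 28 * L ^ 4 * Real.exp b ≤ Real.exp a ∧ K ^ 24 * L ^ 5 ≤ Real.exp b ∧
      Real.exp b ^ 10 * Real.exp a ≤ K * M ^ 4 ∧
      Real.exp a ^ 2 * Real.exp b ^ 8 ≤ L * M ^ 4 := by
    intro k l m hm e1 e2 e3 e4 e5
    have hM4 : Real.exp m ^ 4 ≤ M ^ 4 := pow_le_pow_left₀ (Real.exp_pos _).le hm 4
    refine ⟨Real.exp k, Real.exp l, Real.exp_pos _, Real.exp_pos _, ?_, ?_, ?_, ?_, ?_⟩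
    · rw [← Real.exp_nat_mul, ← Real.exp_nat_mul, ← Real.exp_add, Real.exp_le_exp]
      push_cast; linarith
    · rw [← Real.exp_nat_mul, ← Real.exp_nat_mul, ← Real.exp_add, ← Real.exp_add, Real.exp_le_exp]
      push_cast; linarith
    · rw [← Real.exp_nat_mul, ← Real.exp_nat_mul, ← Real.exp_add, Real.exp_le_exp]
      push_cast; linarith
    · refine le_trans ?_ (mul_le_mul_of_nonneg_left hM4 (Real.exp_pos _).le)
      rw [← Real.exp_nat_mul, ← Real.exp_nat_mul, ← Real.exp_add, ← Real.exp_add, Real.exp_le_exp]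
      push_cast; linarith
    · refine le_trans ?_ (mul_le_mul_of_nonneg_left hM4 (Real.exp_pos _).le)
      rw [← Real.exp_nat_mul, ← Real.exp_nat_mul, ← Real.exp_nat_mul, ← Real.exp_add,
        ← Real.exp_add, Real.exp_le_exp]
      push_cast; linarith
  rcases le_total (2 * b) a with h | h
  · rcases le_total (44 * a) (91 * b) with h' | h'
    · right
      exact key (-a / 8 + 9 / 32 * b) (7 / 8 * a - 55 / 32 * b) _ h₁ (by linarith) (by linarith)
        (by linarith) (by linarith) (by linarith)
    · left
      refine le_trans ?_ h₁
      rw [← Real.exp_nat_mul, Real.exp_le_exp]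
      push_cast; linarith
  · right
    exact key (-3 / 32 * a + 7 / 32 * b) (29 / 32 * a - 57 / 32 * b) _ h₂ (by linarith)
      (by linarith) (by linarith) (by linarith) (by linarith)

theorem norm_trilinear_sum_le_card {F : Type*} [Field F] (ψ : F → ℂ) (hψ : ∀ x, ‖ψ x‖ ≤ 1)
    (X Y Z : Finset F) (α β γ : F → ℂ) (hα : ∀ x ∈ X, ‖α x‖ ≤ 1) (hβ : ∀ y ∈ Y, ‖β y‖ ≤ 1)
    (hγ : ∀ z ∈ Z, ‖γ z‖ ≤ 1) :
    ‖∑ x ∈ X, ∑ y ∈ Y, ∑ z ∈ Z, α x * β y * γ z * ψ (x * y * z)‖ ≤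
      X.card * (Y.card * Z.card) := by
  have h1 : ∀ x ∈ X, ∀ y ∈ Y, ∀ z ∈ Z, ‖α x * β y * γ z * ψ (x * y * z)‖ ≤ 1 := by
    intro x hx y hy z hz
    rw [norm_mul, norm_mul, norm_mul]
    exact mul_le_one₀ (mul_le_one₀ (mul_le_one₀ (hα x hx) (norm_nonneg _) (hβ y hy))
      (norm_nonneg _) (hγ z hz)) (norm_nonneg _) (hψ _)
  calc ‖∑ x ∈ X, ∑ y ∈ Y, ∑ z ∈ Z, α x * β y * γ z * ψ (x * y * z)‖
      ≤ ∑ x ∈ X, ∑ y ∈ Y, ∑ z ∈ Z, (1 : ℝ) :=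
        norm_sum_le_of_le _ fun x hx => norm_sum_le_of_le _ fun y hy =>
          norm_sum_le_of_le _ fun z hz => h1 x hx y hy z hz
    _ = X.card * (Y.card * Z.card) := by simp

theorem trilinear_sum_eq_add {F : Type*} [Field F] [DecidableEq F] (ψ : F → ℂ)
    (X Y Z : Finset F) (α β γ : F → ℂ) :
    ∑ x ∈ X, ∑ y ∈ Y, ∑ z ∈ Z, α x * β y * γ z * ψ (x * y * z) =
      ∑ x ∈ X.filter (· = 0), ∑ y ∈ Y, ∑ z ∈ Z, α x * β y * γ z * ψ (x * y * z) +
      (∑ x ∈ X.filter (· ≠ 0), ∑ y ∈ Y.filter (· = 0), ∑ z ∈ Z,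
          α x * β y * γ z * ψ (x * y * z) +
        ∑ x ∈ X.filter (· ≠ 0), ∑ y ∈ Y.filter (· ≠ 0), ∑ z ∈ Z,
          α x * β y * γ z * ψ (x * y * z)) := by
  rw [← Finset.sum_add_distrib, ← Finset.sum_filter_add_sum_filter_not X (· = 0)]
  congr 1
  exact Finset.sum_congr rfl fun x _ => (Finset.sum_filter_add_sum_filter_not Y (· = 0) _).symm

theorem natLog_add_one_le {n : ℕ} {q : ℝ} (hq : 1 ≤ q) (hn : (n : ℝ) ≤ q) :
    ((Nat.log 2 n + 1 : ℕ) : ℝ) ≤ 2 * Real.log q + 2 := by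
  have hlq := Real.log_nonneg hq
  rcases Nat.eq_zero_or_pos n with rfl | h0
  · simp; linarith
  have h1 : ((2 ^ Nat.log 2 n : ℕ) : ℝ) ≤ q :=
    (Nat.cast_le.2 (Nat.pow_log_le_self 2 h0.ne')).trans hn
  have h2 := Real.log_le_log (by positivity) h1
  push_cast at h2
  rw [Real.log_pow] at h2
  push_cast
  have := Real.log_two_gt_d9
  have h3 : (0 : ℝ) ≤ Nat.log 2 n := Nat.cast_nonneg _
  nlinarith

theorem harmonic_sum_le {n : ℕ} {q : ℝ} (hq : 1 ≤ q) (hn : (n : ℝ) ≤ q) :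
    ∑ i ∈ Finset.range n, (1 : ℝ) / (i + 1) ≤ 2 * Real.log q + 2 := by
  have hlq := Real.log_nonneg hq
  have h1 := harmonic_le_one_add_log n
  have h2 : ((harmonic n : ℚ) : ℝ) = ∑ i ∈ Finset.range n, (1 : ℝ) / (i + 1) := by
    simp [harmonic]
  rw [h2] at h1
  rcases Nat.eq_zero_or_pos n with rfl | h0
  · simp; linarith
  have := Real.log_le_log (Nat.cast_pos.2 h0) hn
  linarith

theorem tendsto_log_log_div_log :
    Tendsto (fun n : ℕ => 2 * Real.log (2 * Real.log n + 2) / Real.log n) atTop (𝓝 0) := by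
  have h1 : Tendsto (fun x : ℝ => 2 * x + 2) atTop atTop :=
    tendsto_atTop_add_const_right _ _ (tendsto_id.const_mul_atTop (by norm_num))
  have h2 : (fun x : ℝ => Real.log (2 * x + 2)) =o[atTop] fun x => 2 * x + 2 :=
    Real.isLittleO_log_id_atTop.comp_tendsto h1
  have h3 : (fun x : ℝ => 2 * x + 2) =O[atTop] fun x => x := by
    refine Asymptotics.IsBigO.of_bound 4 ?_
    filter_upwards [eventually_ge_atTop 1] with x hx
    rw [Real.norm_of_nonneg (by linarith), Real.norm_of_nonneg (by linarith)]
    linarith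
  have h4 := ((h2.trans_isBigO h3).const_mul_left 2).tendsto_div_nhds_zero
  exact h4.comp (Real.tendsto_log_atTop.comp tendsto_natCast_atTop_atTop)

theorem exists_addChar_eq_canonicalChar (p : ℕ) [Fact p.Prime] (F : Type*) [Field F] [Fintype F]
    [Algebra (ZMod p) F] :
    ∃ ψ : AddChar F ℂ, ψ.IsPrimitive ∧ ∀ x, canonicalChar p x = ψ x := by
  refine ⟨ZMod.stdAddChar.compAddMonoidHom (Algebra.trace (ZMod p) F).toAddMonoidHom,
    AddChar.IsPrimitive.of_ne_one ?_, fun x => rfl⟩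
  obtain ⟨x, hx⟩ := Algebra.trace_surjective (ZMod p) F 1
  intro h
  have h1 := DFunLike.congr_fun h x
  have h2 : ZMod.stdAddChar (N := p) (1 : ZMod p) = 1 := by
    rw [← hx]; exact h1
  have h3 : (1 : ZMod p) = 0 := ZMod.injective_stdAddChar (h2.trans (AddChar.map_zero_eq_one _).symm)
  exact one_ne_zero h3

theorem trilinear_sum_le_exp {F : Type*} [Field F] [Fintype F] [DecidableEq F]
    {ψ : AddChar F ℂ} (hψ : ψ.IsPrimitive) (X Y Z : Finset F) (hXY : X.card = Y.card)
    (hYZ : Y.card = Z.card) (hX : 0 < X.card) {C : ℝ} (hanti : SubfieldAntiConcentrated C X)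
    (α β γ : F → ℂ) (hα : ∀ x ∈ X, ‖α x‖ ≤ 1) (hβ : ∀ y ∈ Y, ‖β y‖ ≤ 1)
    (hγ : ∀ z ∈ Z, ‖γ z‖ ≤ 1) {a b M : ℝ} (hb : Real.exp b = X.card)
    (ha : Real.exp a = Fintype.card F)
    (h₁ : Real.exp (36 / 128 * a + 311 / 128 * b) ≤ M)
    (h₂ : Real.exp (35 / 128 * a + 313 / 128 * b) ≤ M) :
    ‖∑ x ∈ X, ∑ y ∈ Y, ∑ z ∈ Z, α x * β y * γ z * ψ (x * y * z)‖ ≤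
      (3 + 2 ^ 16 * (1 + 2 * C ^ 2)) * ((2 * a + 2) ^ 2 * M) := by
  have hb0 : 0 ≤ b := by
    rw [← Real.exp_le_exp, Real.exp_zero, hb]
    exact_mod_cast hX
  have hXq : (X.card : ℝ) ≤ Fintype.card F := Nat.cast_le.2 (Finset.card_le_univ X)
  have hba : b ≤ a := by rwa [← Real.exp_le_exp, hb, ha]
  have hM : 0 < M := (Real.exp_pos _).trans_le h₁
  have ha0 : 0 ≤ a := hb0.trans hba
  obtain ⟨Λ, hΛ⟩ : ∃ Λ, Λ = 2 * a + 2 := ⟨_, rfl⟩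
  have hΛ1 : 1 ≤ Λ := by linarith
  rw [← hΛ]
  have hMΛ : M ≤ Λ ^ 2 * M := le_mul_of_one_le_left hM.le (one_le_pow₀ hΛ1)
  have hMΛ0 : 0 ≤ Λ ^ 2 * M := hM.le.trans hMΛ
  have hc1 : 1 ≤ 1 + 2 * C ^ 2 := by nlinarith [sq_nonneg C]
  have hnorm : ∀ x, ‖ψ x‖ ≤ 1 := fun x => (ψ.norm_apply x).le
  have hN2 : Real.exp b ^ 2 ≤ M := by
    refine le_trans ?_ h₁
    rw [← Real.exp_nat_mul, Real.exp_le_exp]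
    push_cast; linarith
  have hq1 : (1 : ℝ) ≤ Fintype.card F := by rw [← ha]; exact Real.one_le_exp ha0
  have hlogq : Real.log (Fintype.card F) = a := by rw [← ha, Real.log_exp]
  have hYb : (Y.card : ℝ) = Real.exp b := by rw [hb, hXY]
  have hZb : (Z.card : ℝ) = Real.exp b := by rw [hb, hXY, hYZ]
  rcases exists_energy_parameters hb0 h₁ h₂ with h | ⟨K, L, hK, hL, e1, e2, e3, e4, e5⟩
  · refine (norm_trilinear_sum_le_card ψ hnorm X Y Z α β γ hα hβ hγ).trans ?_
    rw [hYb, hZb, ← hb]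
    nlinarith
  have hfα : ∀ P : F → Prop, [DecidablePred P] → ∀ x ∈ X.filter P, ‖α x‖ ≤ 1 :=
    fun P _ x hx => hα x (Finset.mem_filter.1 hx).1
  have hfβ : ∀ P : F → Prop, [DecidablePred P] → ∀ y ∈ Y.filter P, ‖β y‖ ≤ 1 :=
    fun P _ y hy => hβ y (Finset.mem_filter.1 hy).1
  have hone : ∀ U : Finset F, ((U.filter (· = 0)).card : ℝ) ≤ 1 := by
    intro U
    have : (U.filter (· = 0)).card ≤ 1 := Finset.card_le_one.2 fun x hx y hy =>
      (Finset.mem_filter.1 hx).2.trans (Finset.mem_filter.1 hy).2.symm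
    exact_mod_cast this
  have hfc : ∀ U : Finset F, ((U.filter (· ≠ 0)).card : ℝ) ≤ U.card := fun U =>
    Nat.cast_le.2 (Finset.card_filter_le _ _)
  have s1 : ‖∑ x ∈ X.filter (· = 0), ∑ y ∈ Y, ∑ z ∈ Z, α x * β y * γ z * ψ (x * y * z)‖ ≤ M := by
    refine (norm_trilinear_sum_le_card ψ hnorm _ Y Z α β γ (hfα _) hβ hγ).trans ?_
    rw [hYb, hZb]
    refine le_trans ?_ hN2
    rw [sq]
    exact mul_le_of_le_one_left (mul_self_nonneg _) (hone X)
  have s2 : ‖∑ x ∈ X.filter (· ≠ 0), ∑ y ∈ Y.filter (· = 0), ∑ z ∈ Z,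
      α x * β y * γ z * ψ (x * y * z)‖ ≤ M := by
    refine (norm_trilinear_sum_le_card ψ hnorm _ _ Z α β γ (hfα _) (hfβ _) hγ).trans ?_
    refine le_trans ?_ hN2
    rw [sq, hZb]
    refine mul_le_mul ((hfc X).trans hb.symm.le) ?_
      (mul_nonneg (Nat.cast_nonneg _) (Real.exp_pos _).le) (Real.exp_pos _).le
    exact mul_le_of_le_one_left (Real.exp_pos _).le (hone Y)
  have s3 : ‖∑ x ∈ X.filter (· ≠ 0), ∑ y ∈ Y.filter (· ≠ 0), ∑ z ∈ Z,
      α x * β y * γ z * ψ (x * y * z)‖ ≤ M + 2 ^ 16 * (1 + 2 * C ^ 2) * Λ ^ 2 * M := by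
    refine trilinear_sum_le hψ (X.filter (· ≠ 0)) (Y.filter (· ≠ 0)) Z (by simp) (by simp)
      (hanti.mono (Finset.filter_subset _ _)) (Real.exp_pos b) ((hfc X).trans hb.symm.le)
      ((hfc Y).trans hYb.le) hZb.le hK hL hΛ1 ?_ ?_ e1 (ha ▸ e2) e3 hM.le (by positivity)
      (ha ▸ e4) ?_ α β γ (hfα _) (hfβ _) hγ
    · intro n hn
      have := natLog_add_one_le hq1 (hn.trans (hb.le.trans hXq))
      rwa [hlogq, ← hΛ] at this
    · intro n hn
      have := harmonic_sum_le hq1 (hn.trans (hb.le.trans hXq))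
      rwa [hlogq, ← hΛ] at this
    · rw [← ha]
      calc 2 ^ 64 * (1 + 2 * C ^ 2) * Λ ^ 8 * Real.exp a ^ 2 * Real.exp b ^ 8
          = 2 ^ 64 * (1 + 2 * C ^ 2) * Λ ^ 8 * (Real.exp a ^ 2 * Real.exp b ^ 8) := by ring
        _ ≤ 2 ^ 64 * (1 + 2 * C ^ 2) ^ 4 * Λ ^ 8 * (L * M ^ 4) := by
          gcongr
          exact le_self_pow₀ hc1 (by norm_num)
        _ = _ := by ring
  rw [trilinear_sum_eq_add]
  refine (norm_add_le _ _).trans ((add_le_add s1 ((norm_add_le _ _).trans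
    (add_le_add s2 s3))).trans ?_)
  linarith

theorem corollary5 :
    ∃ e : ℕ → ℝ, Tendsto e atTop (𝓝 0) ∧
      ∀ C : ℝ, 0 < C → ∃ K : ℝ, 0 < K ∧
        ∀ (p : ℕ) [Fact p.Prime] (F : Type*) [Field F] [Fintype F] [Algebra (ZMod p) F]
          (X Y Z : Finset F), X.card = Y.card → Y.card = Z.card →
          SubfieldAntiConcentrated C X →
          ∀ α β γ : F → ℂ,
            (∀ x ∈ X, ‖α x‖ ≤ 1) → (∀ y ∈ Y, ‖β y‖ ≤ 1) → (∀ z ∈ Z, ‖γ z‖ ≤ 1) →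
            ‖∑ x ∈ X, ∑ y ∈ Y, ∑ z ∈ Z, α x * β y * γ z * canonicalChar p (x * y * z)‖ ≤
              K * (Fintype.card F : ℝ) ^ (9 / 32 + e (Fintype.card F)) *
                ((X.card : ℝ) ^ (311 / 128 : ℝ) +
                  (Fintype.card F : ℝ) ^ (-1 / 128 : ℝ) * (X.card : ℝ) ^ (313 / 128 : ℝ)) := by
  refine ⟨fun n => 2 * Real.log (2 * Real.log n + 2) / Real.log n, tendsto_log_log_div_log,
    fun C hC => ⟨3 + 2 ^ 16 * (1 + 2 * C ^ 2), by positivity, ?_⟩⟩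
  intro p _ F _ _ _ X Y Z hXY hYZ hanti α β γ hα hβ hγ
  classical
  obtain ⟨ψ, hψ, hcan⟩ := exists_addChar_eq_canonicalChar p F
  simp_rw [hcan]
  have hq1 : (1 : ℝ) < Fintype.card F := by exact_mod_cast Fintype.one_lt_card
  have hq0 : (0 : ℝ) < Fintype.card F := by linarith
  obtain ⟨a, ha⟩ : ∃ a : ℝ, a = Real.log (Fintype.card F) := ⟨_, rfl⟩
  have ha0 : 0 < a := ha ▸ Real.log_pos hq1
  have hexp : Real.exp a = Fintype.card F := by rw [ha, Real.exp_log hq0]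
  rcases Nat.eq_zero_or_pos X.card with h0 | hX
  · rw [Finset.card_eq_zero.1 h0, Finset.sum_empty, norm_zero]
    positivity
  have hX0 : (0 : ℝ) < X.card := Nat.cast_pos.2 hX
  obtain ⟨b, hb⟩ : ∃ b : ℝ, b = Real.log X.card := ⟨_, rfl⟩
  have hexpb : Real.exp b = X.card := by rw [hb, Real.exp_log hX0]
  have hpow : ∀ t : ℝ, (Fintype.card F : ℝ) ^ t = Real.exp (a * t) := fun t => by
    rw [Real.rpow_def_of_pos hq0, ha]
  have hpowb : ∀ t : ℝ, (X.card : ℝ) ^ t = Real.exp (b * t) := fun t => by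
    rw [Real.rpow_def_of_pos hX0, hb]
  have h₁ : Real.exp (36 / 128 * a + 311 / 128 * b) =
      Real.exp (a * (9 / 32)) * Real.exp (b * (311 / 128)) := by
    rw [← Real.exp_add]; ring_nf
  have h₂ : Real.exp (35 / 128 * a + 313 / 128 * b) =
      Real.exp (a * (9 / 32)) * (Real.exp (a * (-1 / 128)) * Real.exp (b * (313 / 128))) := by
    rw [← Real.exp_add, ← Real.exp_add]; ring_nf
  have key := trilinear_sum_le_exp hψ X Y Z hXY hYZ hX hanti α β γ hα hβ hγ hexpb hexp
    (M := Real.exp (36 / 128 * a + 311 / 128 * b) + Real.exp (35 / 128 * a + 313 / 128 * b))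
    (le_add_of_nonneg_right (Real.exp_pos _).le) (le_add_of_nonneg_left (Real.exp_pos _).le)
  refine key.trans (le_of_eq ?_)
  have he : Real.exp (a * (9 / 32 + 2 * Real.log (2 * a + 2) / a)) =
      Real.exp (a * (9 / 32)) * (2 * a + 2) ^ 2 := by
    have h2 : Real.exp (2 * Real.log (2 * a + 2)) = (2 * a + 2) ^ 2 := by
      rw [two_mul, Real.exp_add, Real.exp_log (by positivity), sq]
    rw [mul_add, mul_div_cancel₀ _ ha0.ne', Real.exp_add, h2]
  rw [← ha, hpow, hpow, hpowb, hpowb, he, h₁, h₂]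
  ring
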